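/- **Convergence of RO-TD.** Let $d\ge 0$, $\eta,\gamma\in\mathbb R$, $\rho\ge 0$, and let $m,n\in[1,\infty]$ be conjugate exponents, $\frac1m+\frac1n=1$. Let $(\phi_t,r_t,\phi_t')_{t\ge0}$ be i.i.d. random samples with values in $\mathbb R^d\times\mathbb R\times\mathbb R^d$, and put $$A_t=\begin{bmatrix}\eta\,\phi_t\phi_t^{T}&\eta\,\phi_t(\phi_t-\gamma\phi_t')^{T}\\ \gamma\,\phi_t'\phi_t^{T}&\phi_t(\phi_t-\gamma\phi_t')^{T}\end{bmatrix},\qquad b_t=\begin{bmatrix}\eta\, r_t\phi_t\\ r_t\phi_t\end{bmatrix},$$ with integrable entries, $A=\mathbb E[A_t]$, $b=\mathbb E[b_t]$. Let $Y=\{y\in\mathbb R^{2d}:\|y\|_n\le1\}$, let $\Pi_n$ be the Euclidean projection onto $Y$, and for $x,y\in\mathbb R^{2d}$ let $$F(x)=\|Ax-b\|_m+\rho\|x\|_1,\qquad \varphi(x,y)=y^{T}(Ax-b)+\rho\|x\|_1 .$$ Let $X\subseteq\mathbb R^{2d}$ be nonempty, compact and convex, and $C\supseteq X$ closed and convex (for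 instance $C=X$, or $C=\mathbb R^{2d}$). Given step sizes $\alpha_t>0$ and $x_0\in X$, $y_0\in Y$, RO-TD generates $$x_{t+1}=\operatorname*{argmin}_{z\in C}\Big(\alpha_t\rho\|z\|_1+\tfrac12\|z-(x_t-\alpha_tA_t^{T}y_t)\|_2^2\Big),\qquad y_{t+1}=\Pi_n\big(y_t+\alpha_t(A_tx_t-b_t)\big)$$ (for $C=\mathbb R^{2d}$ the first step is soft thresholding at level $\alpha_t\rho$) and the averages $\bar x_t=S_t^{-1}\sum_{i=0}^t\alpha_ix_i$, $\bar y_t=S_t^{-1}\sum_{i=0}^t\alpha_iy_i$, where $S_t=\sum_{i=0}^t\alpha_i$. Assume that almost surely $x_t\in X$ for all $t$ (automatic if $C=X$), and that the stochastic subgradients are bounded: for a constant $L$, almost surely $\|A_t^{T}y_t\|_2\le L$ and $\|A_tx_t-b_t\|_2\le L$ for all $t$. Then: 1. (Saddle-point form.) $F(x)=\max_{y\in Y}\varphi(x,y)$ for every $x\in\mathbb R^{2d}$; $\varphi(\cdot,y)$ is convex on $X$ for each $y\in Y$, and $\varphi(x,\cdot)$ is concave on $Y$ for each $x\in X$; $\operatorname{argmin}_XF\neq\emptyset$;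 and $x\in X$ minimizes $F$ over $X$ if and only if $(x,y)$ is a saddle point of $\varphi$ on $X\times Y$ for some $y\in Y$. If $\rho>0$ and $X$ contains the Euclidean ball of radius $\|b\|_m/\rho$ about $0$, then $\operatorname{argmin}_XF=\operatorname{argmin}_{\mathbb R^{2d}}F$. 2. (Convergence.) If $\alpha_t\to0$ and $\sum_t\alpha_t=\infty$, then almost surely $\bar x_t\in X$ for all $t$ and the distance from $\bar x_t$ to $\operatorname{argmin}_{x\in X}\big(\|Ax-b\|_m+\rho\|x\|_1\big)$ tends to $0$ (so $\bar x_t\to x^*$ if the minimizer $x^*$ is unique). 3. (Error level.) If $(\alpha_t)$ is non-increasing (for example constant) and $\sum_t\alpha_t=\infty$, then almost surely, for every $\varepsilon>0$ and all sufficiently large $t$, $(\bar x_t,\bar y_t)\in X\times Y$ and $$\varphi(\bar x_t,y)-\varphi(x,\bar y_t)\le\alpha_tL^2+\varepsilon\qquad\text{for all }x\in X,\ y\in Y .$$ Moreover, if $(\alpha_t)$ is non-increasing, then for all $x\in X$, $y\in Y$ and $t\ge0$ the random variable $\varphi(\bar x_t,y)-\varphi(x,\bar y_t)$ is integrable and $$\mathbb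 E\big[\varphi(\bar x_t,y)-\varphi(x,\bar y_t)\big]\le\frac{\|x_0-x\|_2^2+\|y_0-y\|_2^2+2\alpha_0\rho\|x_0\|_1}{2S_t}+\frac{\sum_{i=0}^t\alpha_i^2}{S_t}\,L^2 ,$$ whose last term is $\alpha L^2$ for a constant step size $\alpha$. -/

import Mathlib

open MeasureTheory ProbabilityTheory Filter Topology
open scoped Matrix

namespace ROTD

/-- The Euclidean space `ℝ^{2d}` of the stacked vectors `x = [w; θ]` and of the dual vectors
`y = [y₁; y₂]`. -/
abbrev Vec (d : ℕ) : Type := EuclideanSpace ℝ (Fin d ⊕ Fin d)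

/-- One sample `(φ, r, φ')` : features of the current state, reward, features of the
next state. -/
abbrev Sample (d : ℕ) : Type := (Fin d → ℝ) × ℝ × (Fin d → ℝ)

/-- The `ℓ_p` norm of a vector, `1 ≤ p ≤ ∞`. -/
noncomputable def lpNorm {d : ℕ} (p : ENNReal) (x : Vec d) : ℝ :=
  ‖WithLp.toLp p x.ofLp‖

/-- Matrix times vector, as a vector of the Euclidean space. -/
noncomputable def mul {d : ℕ} (A : Matrix (Fin d ⊕ Fin d) (Fin d ⊕ Fin d) ℝ) (x : Vec d) :
    Vec d :=
  WithLp.toLp 2 (A *ᵥ x.ofLp)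

/-- The TD matrix of a sample,
`A_t = [η φ φᵀ, η φ (φ - γ φ')ᵀ; γ φ' φᵀ, φ (φ - γ φ')ᵀ]`. -/
def sampleMatrix {d : ℕ} (η γ : ℝ) (z : Sample d) :
    Matrix (Fin d ⊕ Fin d) (Fin d ⊕ Fin d) ℝ :=
  Matrix.fromBlocks
    (η • Matrix.vecMulVec z.1 z.1)
    (η • Matrix.vecMulVec z.1 (z.1 - γ • z.2.2))
    (γ • Matrix.vecMulVec z.2.2 z.1)
    (Matrix.vecMulVec z.1 (z.1 - γ • z.2.2))

/-- The TD vector of a sample, `b_t = [η r φ; r φ]`. -/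
def sampleVector {d : ℕ} (η : ℝ) (z : Sample d) : Vec d :=
  WithLp.toLp 2 (Sum.elim ((η * z.2.1) • z.1) (z.2.1 • z.1))

/-- `A = 𝔼[A_t]`, entry by entry, for a random sample `Z`. -/
noncomputable def meanMatrix {d : ℕ} {Ω : Type*} [MeasurableSpace Ω] (P : Measure Ω)
    (η γ : ℝ) (Z : Ω → Sample d) : Matrix (Fin d ⊕ Fin d) (Fin d ⊕ Fin d) ℝ :=
  fun i j => ∫ ω, sampleMatrix η γ (Z ω) i j ∂P

/-- `b = 𝔼[b_t]`, entry by entry, for a random sample `Z`. -/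
noncomputable def meanVector {d : ℕ} {Ω : Type*} [MeasurableSpace Ω] (P : Measure Ω)
    (η : ℝ) (Z : Ω → Sample d) : Vec d :=
  WithLp.toLp 2 (fun i => ∫ ω, sampleVector η (Z ω) i ∂P)

/-- The regularized loss `‖A x - b‖_m + ρ ‖x‖₁`. -/
noncomputable def loss {d : ℕ} (m : ENNReal) (ρ : ℝ)
    (A : Matrix (Fin d ⊕ Fin d) (Fin d ⊕ Fin d) ℝ) (b x : Vec d) : ℝ :=
  lpNorm m (mul A x - b) + ρ * lpNorm 1 x

/-- The saddle function `yᵀ(A x - b) + ρ ‖x‖₁`. -/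
noncomputable def saddle {d : ℕ} (ρ : ℝ)
    (A : Matrix (Fin d ⊕ Fin d) (Fin d ⊕ Fin d) ℝ) (b x y : Vec d) : ℝ :=
  y.ofLp ⬝ᵥ (mul A x - b).ofLp + ρ * lpNorm 1 x

/-- The dual feasible set `Y = {y : ‖y‖_n ≤ 1}`. -/
def dualBall (d : ℕ) (n : ENNReal) : Set (Vec d) := {y | lpNorm n y ≤ 1}

/-- The set of minimizers of `f` over `S`. -/
def argminOn {E : Type*} (S : Set E) (f : E → ℝ) : Set E := {x | x ∈ S ∧ IsMinOn f S x}

open Classical in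
/-- The proximal map `u ↦ argmin_{z ∈ C} (f z + ‖z - u‖² / 2)` of `f` on the set `C`
(the minimizer exists and is unique if `C` is nonempty, closed and convex and `f` is
continuous, convex and nonnegative, which covers every use below). -/
noncomputable def proxOn {d : ℕ} (C : Set (Vec d)) (f : Vec d → ℝ) (u : Vec d) : Vec d :=
  if h : (argminOn C (fun z => f z + ‖z - u‖ ^ 2 / 2)).Nonempty then h.some else u

/-- The Euclidean projection `Π_n` onto the unit `ℓ_n` ball. -/
noncomputable def projBall {d : ℕ} (n : ENNReal) (u : Vec d) : Vec d :=
  proxOn (dualBall d n) (fun _ => 0) u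

/-- The RO-TD iterates `(x_t, y_t)` along a sequence `z` of samples:
`x_{t+1} = prox_{α_t ρ‖·‖₁}(x_t - α_t A_tᵀ y_t)` and
`y_{t+1} = Π_n(y_t + α_t (A_t x_t - b_t))`.  The proximal step is taken over `C`; for
`C = univ` it is soft thresholding. -/
noncomputable def iter {d : ℕ} (η γ ρ : ℝ) (n : ENNReal) (C : Set (Vec d)) (α : ℕ → ℝ)
    (x₀ y₀ : Vec d) (z : ℕ → Sample d) : ℕ → Vec d × Vec d
  | 0 => (x₀, y₀)
  | t + 1 =>
    let p := iter η γ ρ n C α x₀ y₀ z t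
    (proxOn C (fun v => α t * (ρ * lpNorm 1 v))
        (p.1 - α t • mul (sampleMatrix η γ (z t))ᵀ p.2),
      projBall n (p.2 + α t • (mul (sampleMatrix η γ (z t)) p.1 - sampleVector η (z t))))

/-- The step-size weighted average `(∑_{i ≤ t} α_i)⁻¹ ∑_{i ≤ t} α_i v_i`. -/
noncomputable def average {d : ℕ} (α : ℕ → ℝ) (v : ℕ → Vec d) (t : ℕ) : Vec d :=
  (∑ i ∈ Finset.range (t + 1), α i)⁻¹ • ∑ i ∈ Finset.range (t + 1), α i • v i

/-- `(a, b)` is an approximate saddle point of `f` on `X × Y` with error level `e`: its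
primal-dual gap `sup_{y ∈ Y} f a y - inf_{x ∈ X} f x b` is at most `e`. -/
def IsApproxSaddle {E F : Type*} (X : Set E) (Y : Set F) (f : E → F → ℝ) (e : ℝ)
    (a : E) (b : F) : Prop :=
  a ∈ X ∧ b ∈ Y ∧ ∀ x ∈ X, ∀ y ∈ Y, f a y - f x b ≤ e

end ROTD

/-! The saddle-point form is duality plus minimax. The equality case of Hölder's inequality
(`exists_dot_eq_lpNorm`) makes the loss F the maximum of φ over the dual ball, and Sion's theorem
gives a saddle point whose dual component serves every minimizer (`mem_argminOn_loss_iff`).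

The convergence proof separates a deterministic estimate from a probabilistic one. Along a fixed
sample sequence, RO-TD is a proximal step in x and a projected ascent step in y for the sampled
saddle function. The variational inequality of the proximal map makes the squared distance to any
reference pair (v, u) telescope, so the weighted sum of sampled gaps is at most a constant plus a
multiple of ∑ α_i² (`sum_sampleGap_le_of_antitone`, `sum_sampleGap_le`).

Replacing A_t, b_t by A, b costs `gapNoise`, which has mean zero given the past because (x_t, y_t)
depends only on samples before time t. It is affine in (v, u), and its finitely many coefficients
are bounded thanks to L. The strong law `ae_tendsto_weighted_average`, applied to each coefficient,
therefore makes the averaged noise vanish uniformly over X × Y (`ae_exists_gapNoise_bound`). This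
law needs only bounded steps with divergent sum, not ∑ α_i² < ∞.

After division by S_t, Jensen's inequality passes to the averaged iterates, and the surviving error
is governed by ∑ α_i² / S_t, which has the same limit as α_t. The gap dominates F(x̄_t) - min F, and
compactness of X turns convergence of values into convergence to the minimizers. For the bound in
expectation the pathwise estimate is integrated, and the noise drops out. -/

namespace ROTD

/-! ### ℓ_p norms and Hölder duality. -/

section LpNorm
variable {d : ℕ}

lemma lpNorm_nonneg (p : ENNReal) [Fact (1 ≤ p)] (x : Vec d) : 0 ≤ lpNorm p x := norm_nonneg _

lemma lpNorm_zero (p : ENNReal) [Fact (1 ≤ p)] : lpNorm p (0 : Vec d) = 0 := by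
  simp [lpNorm]

lemma lpNorm_neg (p : ENNReal) [Fact (1 ≤ p)] (x : Vec d) : lpNorm p (-x) = lpNorm p x := by
  simp [lpNorm]

lemma lpNorm_add_le (p : ENNReal) [Fact (1 ≤ p)] (x y : Vec d) :
    lpNorm p (x + y) ≤ lpNorm p x + lpNorm p y := by
  simpa [lpNorm] using norm_add_le (WithLp.toLp p x.ofLp) (WithLp.toLp p y.ofLp)

lemma lpNorm_smul (p : ENNReal) [Fact (1 ≤ p)] (c : ℝ) (x : Vec d) :
    lpNorm p (c • x) = |c| * lpNorm p x := by
  simpa [lpNorm] using norm_smul c (WithLp.toLp p x.ofLp)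

lemma convexOn_lpNorm (p : ENNReal) [Fact (1 ≤ p)] (s : Set (Vec d)) (hs : Convex ℝ s) :
    ConvexOn ℝ s (lpNorm p) := by
  refine ⟨hs, fun x _ y _ a b ha hb _ => ?_⟩
  have := lpNorm_add_le p (a • x) (b • y)
  rwa [lpNorm_smul, lpNorm_smul, abs_of_nonneg ha, abs_of_nonneg hb] at this

lemma continuous_lpNorm (p : ENNReal) [Fact (1 ≤ p)] : Continuous (lpNorm p : Vec d → ℝ) :=
  ((PiLp.continuous_toLp p _).comp (PiLp.continuous_ofLp 2 _)).norm

lemma abs_apply_le_lpNorm (p : ENNReal) [Fact (1 ≤ p)] (x : Vec d) (i : Fin d ⊕ Fin d) :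
    |x i| ≤ lpNorm p x :=
  PiLp.norm_apply_le (p := p) (WithLp.toLp p x.ofLp) i

lemma lpNorm_one_eq (x : Vec d) : lpNorm 1 x = ∑ i, |x i| := by
  simp [lpNorm, PiLp.norm_eq_of_L1]

lemma norm_le_lpNorm_one (x : Vec d) : ‖x‖ ≤ lpNorm 1 x := by
  rw [EuclideanSpace.norm_eq, lpNorm_one_eq]
  refine Real.sqrt_le_iff.2 ⟨by positivity, ?_⟩
  simpa using Finset.sum_sq_le_sq_sum_of_nonneg (s := Finset.univ) (f := fun i => |x i|)
    (fun i _ => abs_nonneg _)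

lemma lpNorm_one_le (x : Vec d) : lpNorm 1 x ≤ (2 * d) * ‖x‖ := by
  rw [lpNorm_one_eq]
  calc ∑ i, |x i| ≤ ∑ _i : Fin d ⊕ Fin d, ‖x‖ :=
        Finset.sum_le_sum fun i _ => PiLp.norm_apply_le x i
    _ = (2 * d) * ‖x‖ := by
        rw [Finset.sum_const, nsmul_eq_mul, Finset.card_univ, Fintype.card_sum, Fintype.card_fin]
        push_cast; ring

lemma lpNorm_one_sub_le (x y : Vec d) : lpNorm 1 x - lpNorm 1 y ≤ (2 * d) * ‖x - y‖ := by
  have := lpNorm_add_le 1 (x - y) y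
  rw [sub_add_cancel] at this
  linarith [lpNorm_one_le (x - y)]

lemma dot_le_one_top (a b : Vec d) : ∑ i, |a i| * |b i| ≤ lpNorm 1 a * lpNorm ⊤ b := by
  rw [lpNorm_one_eq, Finset.sum_mul]
  exact Finset.sum_le_sum fun i _ =>
    mul_le_mul_of_nonneg_left (abs_apply_le_lpNorm ⊤ b i) (abs_nonneg _)

lemma lpNorm_eq_of_ne_top {p : ENNReal} (hp : 0 < p.toReal) (x : Vec d) :
    lpNorm p x = (∑ i, |x i| ^ p.toReal) ^ (1 / p.toReal) := by
  rw [lpNorm, PiLp.norm_eq_sum hp]; rfl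

lemma dot_le_mul_lpNorm {m n : ENNReal} (h : ENNReal.HolderConjugate m n) (v y : Vec d) :
    y.ofLp ⬝ᵥ v.ofLp ≤ lpNorm n y * lpNorm m v := by
  have habs : y.ofLp ⬝ᵥ v.ofLp ≤ ∑ i, |y i| * |v i| :=
    Finset.sum_le_sum fun i _ => by rw [← abs_mul]; exact le_abs_self _
  by_cases hm : m = ⊤
  · subst hm
    have : n = 1 := by simpa using ENNReal.holderConjugate_iff.1 h
    subst this
    exact habs.trans (dot_le_one_top y v)
  by_cases hn : n = ⊤
  · subst hn
    have : m = 1 := by simpa using ENNReal.holderConjugate_iff.1 h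
    subst this
    refine habs.trans ?_
    rw [mul_comm]
    simpa only [mul_comm] using dot_le_one_top v y
  have hc := ENNReal.HolderConjugate.toReal_of_ne_top (p := n) (q := m) hn hm
  rw [lpNorm_eq_of_ne_top hc.pos, lpNorm_eq_of_ne_top hc.symm.pos]
  exact Real.inner_le_Lp_mul_Lq _ _ _ hc

/-- Extremal vectors: for m = ∞ a signed basis vector at a coordinate of largest modulus (or 0 if d
= 0), for m = 1 the sign vector, and otherwise the signs of v times the nonnegative maximizer from
`NNReal.isGreatest_Lp`. -/
lemma exists_dot_eq_lpNorm {m n : ENNReal} (h : ENNReal.HolderConjugate m n) (v : Vec d) :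
    ∃ y ∈ dualBall d n, y.ofLp ⬝ᵥ v.ofLp = lpNorm m v := by
  have hs : ∀ a : ℝ, SignType.sign a * a = |a| := fun a => by
    rw [mul_comm]; exact self_mul_sign a
  have hs1 : ∀ a : ℝ, |(SignType.sign a : ℝ)| ≤ 1 := fun a => by
    rcases lt_trichotomy a 0 with h | h | h <;> simp [h]
  by_cases hm : m = ⊤
  · subst hm
    have : n = 1 := by simpa using ENNReal.holderConjugate_iff.1 h
    subst this
    have hv : lpNorm ⊤ v = ⨆ i, |v i| := PiLp.norm_eq_ciSup _
    rcases isEmpty_or_nonempty (Fin d ⊕ Fin d) with he | he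
    · refine ⟨0, ?_, ?_⟩
      · simp [dualBall, lpNorm_zero]
      · rw [hv]; simp
    · obtain ⟨i, hi⟩ := exists_eq_ciSup_of_finite (f := fun i => |v i|)
      refine ⟨WithLp.toLp 2 (Pi.single i (SignType.sign (v i) : ℝ)), ?_, ?_⟩
      · exact (PiLp.norm_single (p := 1) (fun _ => ℝ) i (SignType.sign (v i) : ℝ)).le.trans (hs1 _)
      · rw [hv, ← hi, single_dotProduct]
        exact hs _
  by_cases hn : n = ⊤
  · subst hn
    have : m = 1 := by simpa using ENNReal.holderConjugate_iff.1 h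
    subst this
    refine ⟨WithLp.toLp 2 fun i => (SignType.sign (v i) : ℝ), ?_, ?_⟩
    · simp only [dualBall, Set.mem_ofPred_eq, lpNorm, PiLp.norm_eq_ciSup]
      exact Real.iSup_le (fun i => hs1 _) zero_le_one
    · rw [lpNorm_one_eq]
      exact Finset.sum_congr rfl fun i _ => hs _
  have hc := ENNReal.HolderConjugate.toReal_of_ne_top (p := m) (q := n) hm hn
  obtain ⟨⟨g, hg, hg'⟩, -⟩ := NNReal.isGreatest_Lp Finset.univ (fun i => ‖v i‖₊) hc
  refine ⟨WithLp.toLp 2 fun i => (SignType.sign (v i) : ℝ) * g i, ?_, ?_⟩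
  · simp only [dualBall, Set.mem_ofPred_eq]
    rw [lpNorm_eq_of_ne_top hc.symm.pos]
    refine Real.rpow_le_one (by positivity) ?_ (by have := hc.symm.pos; positivity)
    calc _ ≤ ∑ i, ((g i : ℝ)) ^ n.toReal := Finset.sum_le_sum fun i _ => by
          refine Real.rpow_le_rpow (abs_nonneg _) ?_ hc.symm.pos.le
          rw [abs_mul, NNReal.abs_eq]
          exact mul_le_of_le_one_left (g i).2 (hs1 _)
      _ ≤ 1 := by exact_mod_cast hg
  · rw [lpNorm_eq_of_ne_top hc.pos]
    have := congrArg NNReal.toReal hg'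
    push_cast at this
    simp only [Real.norm_eq_abs] at this
    rw [← this]
    refine Finset.sum_congr rfl fun i _ => ?_
    rw [← hs]; simp only; ring

lemma fact_one_le_left {m n : ENNReal} (h : ENNReal.HolderConjugate m n) : Fact (1 ≤ m) :=
  ⟨ENNReal.HolderConjugate.one_le m n⟩

end LpNorm

/-! ### The dual feasible set. -/

section DualBall
variable {d : ℕ} (n : ENNReal) [Fact (1 ≤ n)]

lemma zero_mem_dualBall : (0 : Vec d) ∈ dualBall d n := by simp [dualBall, lpNorm_zero]

lemma convex_dualBall : Convex ℝ (dualBall d n) := by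
  simpa [dualBall] using (convexOn_lpNorm n Set.univ (convex_univ (E := Vec d))).convex_le 1

lemma isClosed_dualBall : IsClosed (dualBall d n) :=
  isClosed_le (continuous_lpNorm n) continuous_const

lemma norm_le_of_mem_dualBall {y : Vec d} (hy : y ∈ dualBall d n) : ‖y‖ ≤ 2 * d := by
  refine (norm_le_lpNorm_one y).trans ?_
  rw [lpNorm_one_eq]
  calc ∑ i, |y i| ≤ ∑ _i : Fin d ⊕ Fin d, (1 : ℝ) :=
        Finset.sum_le_sum fun i _ => (abs_apply_le_lpNorm n y i).trans hy
    _ = 2 * d := by simp; ring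

lemma isCompact_dualBall : IsCompact (dualBall d n) :=
  Metric.isCompact_of_isClosed_isBounded (isClosed_dualBall n)
    (isBounded_iff_forall_norm_le.2 ⟨_, fun _ hy => norm_le_of_mem_dualBall n hy⟩)

end DualBall

/-! ### The saddle function and the minimizers of the loss. -/

section Saddle
variable {d : ℕ} (ρ : ℝ) (A : Matrix (Fin d ⊕ Fin d) (Fin d ⊕ Fin d) ℝ) (b : Vec d)

lemma dot_eq_inner (y v : Vec d) : y.ofLp ⬝ᵥ v.ofLp = inner ℝ y v := by
  rw [EuclideanSpace.inner_eq_star_dotProduct, dotProduct_comm]; rfl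

lemma saddle_eq (x y : Vec d) :
    saddle ρ A b x y = inner ℝ y (mul A x - b) + ρ * lpNorm 1 x := by
  rw [saddle, dot_eq_inner]

lemma mul_vec_add (x y : Vec d) : mul A (x + y) = mul A x + mul A y := by
  simp [mul, Matrix.mulVec_add]

lemma mul_vec_smul (c : ℝ) (x : Vec d) : mul A (c • x) = c • mul A x := by
  simp [mul, Matrix.mulVec_smul]

lemma mul_vec_sub (x y : Vec d) : mul A (x - y) = mul A x - mul A y := by
  simp [mul, Matrix.mulVec_sub]

lemma inner_mul_transpose (x y : Vec d) : inner ℝ (mul Aᵀ y) x = inner ℝ y (mul A x) := by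
  rw [← dot_eq_inner, ← dot_eq_inner, mul, mul, Matrix.mulVec_transpose, Matrix.dotProduct_mulVec]

lemma continuous_mul :
    Continuous fun p : Matrix (Fin d ⊕ Fin d) (Fin d ⊕ Fin d) ℝ × Vec d => mul p.1 p.2 :=
  (PiLp.continuous_toLp 2 _).comp
    (continuous_fst.matrix_mulVec ((PiLp.continuous_ofLp 2 _).comp continuous_snd))

lemma continuous_saddle : Continuous fun p : Vec d × Vec d => saddle ρ A b p.1 p.2 := by
  simp_rw [saddle_eq]
  have h1 : Continuous fun p : Vec d × Vec d => mul A p.1 :=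
    continuous_mul.comp (continuous_const.prodMk continuous_fst)
  have h2 : Continuous fun p : Vec d × Vec d => lpNorm 1 p.1 :=
    (continuous_lpNorm 1).comp continuous_fst
  fun_prop

variable {ρ}

lemma convexOn_saddle (hρ : 0 ≤ ρ) {X : Set (Vec d)} (hX : Convex ℝ X) (y : Vec d) :
    ConvexOn ℝ X fun x => saddle ρ A b x y := by
  refine ⟨hX, fun x hx z hz s t hs ht hst => ?_⟩
  have h := mul_le_mul_of_nonneg_left ((convexOn_lpNorm 1 X hX).2 hx hz hs ht hst) hρ
  simp only [saddle_eq, mul_vec_add, mul_vec_smul, inner_add_right, inner_sub_right,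
    inner_smul_right, smul_eq_mul] at h ⊢
  have : inner ℝ y b = s * inner ℝ y b + t * inner ℝ y b := by rw [← add_mul, hst, one_mul]
  linarith

lemma concaveOn_saddle {Y : Set (Vec d)} (hY : Convex ℝ Y) (x : Vec d) :
    ConcaveOn ℝ Y fun y => saddle ρ A b x y := by
  refine ⟨hY, fun y _ z _ s t _ _ hst => le_of_eq ?_⟩
  simp only [saddle_eq, inner_add_left, real_inner_smul_left, smul_eq_mul]
  linear_combination (ρ * lpNorm 1 x) * hst

variable {m n : ENNReal}

lemma isGreatest_loss (h : ENNReal.HolderConjugate m n) (v : Vec d) :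
    IsGreatest ((fun u => saddle ρ A b v u) '' dualBall d n) (loss m ρ A b v) := by
  have := fact_one_le_left h
  refine ⟨?_, ?_⟩
  · obtain ⟨y, hy, hy'⟩ := exists_dot_eq_lpNorm h (mul A v - b)
    exact ⟨y, hy, by simp only [saddle, loss, hy']⟩
  · rintro _ ⟨y, hy, rfl⟩
    have h1 := dot_le_mul_lpNorm h (mul A v - b) y
    have h2 := mul_le_of_le_one_left (lpNorm_nonneg m (mul A v - b)) hy
    simp only [saddle, loss]
    linarith

lemma continuous_loss [Fact (1 ≤ m)] : Continuous (loss m ρ A b) := by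
  have h1 : Continuous fun x : Vec d => mul A x :=
    continuous_mul.comp (continuous_const.prodMk continuous_id)
  exact ((continuous_lpNorm m).comp (h1.sub continuous_const)).add
    ((continuous_lpNorm 1).const_mul ρ)

lemma argminOn_loss_nonempty [Fact (1 ≤ m)] {X : Set (Vec d)} (hX : IsCompact X)
    (hne : X.Nonempty) : (argminOn X (loss m ρ A b)).Nonempty :=
  hX.exists_isMinOn hne (continuous_loss A b).continuousOn

/-- Sion's theorem produces some saddle point (p, q), not necessarily with p = v. Its dual part q
still works for a minimizer v, since φ(v, y) ≤ F(v) ≤ F(p) ≤ φ(x, q). For the converse, the saddle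
inequality is tested at a y attaining F(v). -/
lemma mem_argminOn_loss_iff (h : ENNReal.HolderConjugate m n) (hρ : 0 ≤ ρ) {X : Set (Vec d)}
    (hX : IsCompact X) (hXc : Convex ℝ X) {v : Vec d} (hv : v ∈ X) :
    v ∈ argminOn X (loss m ρ A b) ↔
      ∃ u ∈ dualBall d n, IsSaddlePointOn X (dualBall d n) (saddle ρ A b) v u := by
  have := fact_one_le_left h
  have := fact_one_le_left (ENNReal.HolderConjugate.symm (hpq := h))
  have hG := isGreatest_loss (ρ := ρ) A b h
  have hle : ∀ x, ∀ y ∈ dualBall d n, saddle ρ A b x y ≤ loss m ρ A b x := fun x y hy =>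
    (hG x).2 ⟨y, hy, rfl⟩
  constructor
  · rintro ⟨-, hmin⟩
    obtain ⟨p, hp, q, hq, hs⟩ := Sion.exists_isSaddlePointOn (f := saddle ρ A b) ⟨v, hv⟩ hXc hX
      (fun y _ => ((continuous_saddle ρ A b).comp
        (continuous_id.prodMk continuous_const)).lowerSemicontinuous.lowerSemicontinuousOn _)
      (fun y _ => (convexOn_saddle A b hρ hXc y).quasiconvexOn)
      (convex_dualBall n) ⟨0, zero_mem_dualBall n⟩ (isCompact_dualBall n)
      (fun x _ => ((continuous_saddle ρ A b).comp
        (continuous_const.prodMk continuous_id)).upperSemicontinuous.upperSemicontinuousOn _)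
      (fun x _ => (concaveOn_saddle A b (convex_dualBall n) x).quasiconcaveOn)
    refine ⟨q, hq, fun x hx y hy => ?_⟩
    obtain ⟨w, hw, hw'⟩ := (hG p).1
    calc saddle ρ A b v y ≤ loss m ρ A b v := hle v y hy
      _ ≤ loss m ρ A b p := hmin hp
      _ = saddle ρ A b p w := hw'.symm
      _ ≤ _ := hs x hx w hw
  · rintro ⟨u, hu, hs⟩
    refine ⟨hv, fun x hx => ?_⟩
    obtain ⟨w, hw, hw'⟩ := (hG v).1
    change loss m ρ A b v ≤ loss m ρ A b x
    rw [← hw']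
    exact (hs x hx w hw).trans (hle x u hu)

/-- Outside X the regularizer alone exceeds F(0) = ‖b‖_m, because ‖z‖₂ ≤ ‖z‖₁. -/
lemma argminOn_loss_eq_univ [Fact (1 ≤ m)] (hρ : 0 < ρ) {X : Set (Vec d)}
    (hX : Metric.closedBall 0 (lpNorm m b / ρ) ⊆ X) :
    argminOn X (loss m ρ A b) = argminOn Set.univ (loss m ρ A b) := by
  have h0 : loss m ρ A b 0 = lpNorm m b := by
    simp [loss, mul, lpNorm_zero, lpNorm_neg]
  have h0X : (0 : Vec d) ∈ X :=
    hX (Metric.mem_closedBall_self (div_nonneg (lpNorm_nonneg m b) hρ.le))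
  have key : ∀ z ∉ X, lpNorm m b < loss m ρ A b z := fun z hz => by
    have hz' : lpNorm m b / ρ < ‖z‖ := by
      by_contra! hle
      exact hz (hX (by simpa using hle))
    rw [div_lt_iff₀ hρ] at hz'
    have h1 := mul_le_mul_of_nonneg_left (norm_le_lpNorm_one z) hρ.le
    have h2 := lpNorm_nonneg m (mul A z - b)
    unfold loss
    linarith
  ext v
  constructor
  · rintro ⟨hv, hmin⟩
    refine ⟨trivial, fun z _ => ?_⟩
    by_cases hz : z ∈ X
    · exact hmin hz
    · exact (hmin h0X).trans (h0.le.trans (key z hz).le)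
  · rintro ⟨-, hmin⟩
    refine ⟨?_, fun z _ => hmin trivial⟩
    by_contra hv
    have : loss m ρ A b v ≤ loss m ρ A b 0 := hmin (Set.mem_univ 0)
    linarith [key v hv]

end Saddle
-- The proximal map.
section Prox
variable {d : ℕ} {C : Set (Vec d)} {f : Vec d → ℝ}

lemma proxOn_mem_argminOn (hC : IsClosed C) (hne : C.Nonempty) (hf : Continuous f)
    (hf0 : ∀ z, 0 ≤ f z) (u : Vec d) :
    proxOn C f u ∈ argminOn C (fun z => f z + ‖z - u‖ ^ 2 / 2) := by
  have h : (argminOn C (fun z => f z + ‖z - u‖ ^ 2 / 2)).Nonempty := by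
    obtain ⟨z₀, hz₀⟩ := hne
    have hcont : Continuous fun z => f z + ‖z - u‖ ^ 2 / 2 := by fun_prop
    have htend : Tendsto (fun z : Vec d => ‖z - u‖ ^ 2 / 2) (cocompact _) atTop := by
      refine Tendsto.atTop_div_const two_pos ((tendsto_pow_atTop two_ne_zero).comp ?_)
      simpa only [dist_eq_norm] using tendsto_dist_right_cocompact_atTop u
    have hev : ∀ᶠ z in cocompact (Vec d) ⊓ 𝓟 C,
        f z₀ + ‖z₀ - u‖ ^ 2 / 2 ≤ f z + ‖z - u‖ ^ 2 / 2 :=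
      ((htend.eventually_ge_atTop _).filter_mono inf_le_left).mono fun z hz =>
        hz.trans (le_add_of_nonneg_left (hf0 z))
    obtain ⟨z, hz, hmin⟩ := hcont.continuousOn.exists_isMinOn' hC hz₀ hev
    exact ⟨z, hz, hmin⟩
  rw [proxOn, dif_pos h]
  exact h.some_mem

/-- First-order optimality without subgradients: p is compared with (1 - s) p + s z, the inequality
is divided by s, and s tends to 0. -/
lemma sub_le_inner_of_mem_argminOn (hf : ConvexOn ℝ C f) {u p z : Vec d}
    (hp : p ∈ argminOn C (fun z => f z + ‖z - u‖ ^ 2 / 2)) (hz : z ∈ C) :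
    f p - f z ≤ inner ℝ (u - p) (p - z) := by
  have key : ∀ s : ℝ, 0 < s → s ≤ 1 →
      f p - f z - inner ℝ (u - p) (p - z) ≤ s * (‖p - z‖ ^ 2 / 2) := by
    intro s hs hs1
    have hmem := hf.1 hp.1 hz (sub_nonneg.2 hs1) hs.le (by ring)
    have h1 : f p + ‖p - u‖ ^ 2 / 2 ≤ _ := hp.2 hmem
    have h2 := hf.2 hp.1 hz (sub_nonneg.2 hs1) hs.le (by ring)
    have h3 : (1 - s) • p + s • z - u = (p - u) - s • (p - z) := by module
    simp only [h3, norm_sub_sq_real, norm_smul, inner_smul_right, smul_eq_mul, Real.norm_eq_abs,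
      mul_pow, sq_abs] at h1 h2
    rw [show u - p = -(p - u) by abel, inner_neg_left]
    have h4 : s * (f p - f z + inner ℝ (p - u) (p - z)) ≤ s * (s * (‖p - z‖ ^ 2 / 2)) := by
      rw [norm_sub_sq_real p z]; linarith
    linarith [le_of_mul_le_mul_left h4 hs]
  have hlim : Tendsto (fun s : ℝ => s * (‖p - z‖ ^ 2 / 2)) (𝓝[>] 0) (𝓝 0) := by
    have : Tendsto (fun s : ℝ => s * (‖p - z‖ ^ 2 / 2)) (𝓝 0) (𝓝 (0 * (‖p - z‖ ^ 2 / 2))) :=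
      tendsto_id.mul_const _
    rw [zero_mul] at this
    exact this.mono_left nhdsWithin_le_nhds
  have := ge_of_tendsto hlim (by
    filter_upwards [Ioc_mem_nhdsGT (zero_lt_one (α := ℝ))] with s hs using key s hs.1 hs.2)
  linarith

/-- Adding the variational inequalities at the two proximal points shows that the map is
nonexpansive. Continuity is what makes the iterates measurable. -/
lemma continuous_proxOn (hC : IsClosed C) (hne : C.Nonempty) (hf : Continuous f)
    (hf0 : ∀ z, 0 ≤ f z) (hfc : ConvexOn ℝ C f) : Continuous (proxOn C f) := by
  refine (LipschitzWith.of_dist_le_mul (K := 1) fun u v => ?_).continuous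
  have hu := proxOn_mem_argminOn hC hne hf hf0 u
  have hv := proxOn_mem_argminOn hC hne hf hf0 v
  generalize proxOn C f u = p at *
  generalize proxOn C f v = q at *
  have h1 := sub_le_inner_of_mem_argminOn hfc hu hv.1
  have h2 := sub_le_inner_of_mem_argminOn hfc hv hu.1
  rw [dist_eq_norm, dist_eq_norm, NNReal.coe_one, one_mul]
  have h3 : ‖p - q‖ ^ 2 ≤ inner ℝ (u - v) (p - q) := by
    have e : inner ℝ (u - p) (p - q) + inner ℝ (v - q) (q - p)
        = inner ℝ (u - v) (p - q) - ‖p - q‖ ^ 2 := by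
      rw [← real_inner_self_eq_norm_sq, ← inner_sub_left, show q - p = -(p - q) by abel,
        inner_neg_right, ← sub_eq_add_neg, ← inner_sub_left]
      congr 1; abel
    linarith
  have h4 := real_inner_le_norm (u - v) (p - q)
  by_contra! hlt
  nlinarith [norm_nonneg (u - v), norm_nonneg (p - q)]

/-- One proximal gradient step decreases the squared distance to a point of `C`. -/
lemma proximal_step_le {a : ℝ} {x g p z : Vec d} (hf : ConvexOn ℝ C f)
    (hp : p ∈ argminOn C (fun z => f z + ‖z - (x - a • g)‖ ^ 2 / 2)) (hz : z ∈ C) :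
    2 * (f p - f z) + 2 * a * inner ℝ g (x - z) ≤
      ‖x - z‖ ^ 2 - ‖p - z‖ ^ 2 - ‖x - p‖ ^ 2 + 2 * a * inner ℝ g (x - p) := by
  have h := sub_le_inner_of_mem_argminOn hf hp hz
  have e1 : x - a • g - p = (x - p) - a • g := by abel
  have e2 : x - z = (x - p) + (p - z) := by abel
  rw [e1, inner_sub_left, real_inner_smul_left] at h
  rw [e2, inner_add_right, norm_add_sq_real]
  linarith

/-- Completing the square. With w = x - p it absorbs the last two terms of `proximal_step_le` into
an error of order a². -/
lemma two_mul_inner_sub_sq_le (a : ℝ) (g w : Vec d) :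
    2 * a * inner ℝ g w - ‖w‖ ^ 2 ≤ a ^ 2 * ‖g‖ ^ 2 := by
  have h := sq_nonneg ‖w - a • g‖
  rw [norm_sub_sq_real, norm_smul, mul_pow, Real.norm_eq_abs, sq_abs, inner_smul_right,
    real_inner_comm] at h
  linarith

end Prox

/-! ### Pathwise gap estimates. -/

section Iterates
variable {d : ℕ} {η γ ρ : ℝ} {n : ENNReal} {C : Set (Vec d)} {α : ℕ → ℝ} {x₀ y₀ : Vec d}
  {z : ℕ → Sample d} {L : ℝ}

/-- The increment of the saddle function of one sample. -/
lemma saddle_sub_saddle (A : Matrix (Fin d ⊕ Fin d) (Fin d ⊕ Fin d) ℝ) (b x y v u : Vec d) :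
    saddle ρ A b x u - saddle ρ A b v y =
      inner ℝ (mul Aᵀ y) (x - v) - inner ℝ (mul A x - b) (y - u) +
        ρ * (lpNorm 1 x - lpNorm 1 v) := by
  rw [saddle_eq, saddle_eq, inner_mul_transpose, mul_vec_sub, inner_sub_right (mul A x - b),
    real_inner_comm y, real_inner_comm u]
  simp only [inner_sub_right]
  ring

variable (η γ ρ n C α x₀ y₀ z)

/-- The bounds on the stochastic subgradients along one trajectory. -/
def SubgradBound (L : ℝ) : Prop := ∀ t,
  ‖mul (sampleMatrix η γ (z t))ᵀ (iter η γ ρ n C α x₀ y₀ z t).2‖ ≤ L ∧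
  ‖mul (sampleMatrix η γ (z t)) (iter η γ ρ n C α x₀ y₀ z t).1 - sampleVector η (z t)‖ ≤ L

/-- The primal-dual gap of the sampled saddle function at an iterate. -/
noncomputable def sampleGap (v u : Vec d) (t : ℕ) : ℝ :=
  saddle ρ (sampleMatrix η γ (z t)) (sampleVector η (z t)) (iter η γ ρ n C α x₀ y₀ z t).1 u -
    saddle ρ (sampleMatrix η γ (z t)) (sampleVector η (z t)) v (iter η γ ρ n C α x₀ y₀ z t).2

/-- The squared distance of an iterate to a reference pair. -/
noncomputable def sqDist (v u : Vec d) (t : ℕ) : ℝ :=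
  ‖(iter η γ ρ n C α x₀ y₀ z t).1 - v‖ ^ 2 + ‖(iter η γ ρ n C α x₀ y₀ z t).2 - u‖ ^ 2

variable {η γ ρ n C α x₀ y₀ z}

lemma convexOn_const_mul_lpNorm_one (hC : Convex ℝ C) {c : ℝ} (hc : 0 ≤ c) (hρ : 0 ≤ ρ) :
    ConvexOn ℝ C (fun v : Vec d => c * (ρ * lpNorm 1 v)) :=
  ((convexOn_lpNorm 1 C hC).smul hρ).smul hc

lemma proxOn_lpNorm_mem (hC : IsClosed C) (hne : C.Nonempty) {c : ℝ} (hc : 0 ≤ c) (hρ : 0 ≤ ρ)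
    (u : Vec d) : proxOn C (fun v => c * (ρ * lpNorm 1 v)) u ∈
      argminOn C (fun z => c * (ρ * lpNorm 1 z) + ‖z - u‖ ^ 2 / 2) :=
  proxOn_mem_argminOn hC hne (((continuous_lpNorm 1).const_mul ρ).const_mul c)
    (fun z => mul_nonneg hc (mul_nonneg hρ (lpNorm_nonneg 1 z))) u

lemma projBall_mem_argminOn [Fact (1 ≤ n)] (u : Vec d) :
    projBall n u ∈ argminOn (dualBall d n) (fun z => 0 + ‖z - u‖ ^ 2 / 2) :=
  proxOn_mem_argminOn (isClosed_dualBall n) ⟨0, zero_mem_dualBall n⟩ continuous_const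
    (fun _ => le_rfl) u

lemma iter_snd_mem [Fact (1 ≤ n)] (hy₀ : y₀ ∈ dualBall d n) :
    ∀ t, (iter η γ ρ n C α x₀ y₀ z t).2 ∈ dualBall d n
  | 0 => hy₀
  | _ + 1 => (projBall_mem_argminOn _).1

variable (hρ : 0 ≤ ρ) (hα : ∀ t, 0 < α t) (hC : IsClosed C) (hCc : Convex ℝ C)
include hρ hα hC hCc

/-- The regularizer appears at the new iterate, whereas the gap needs it at the old one. The term
-‖x_t - x_{t+1}‖² is kept because the two summation lemmas repair this mismatch, and spend that
term, differently. -/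
lemma step_fst {v : Vec d} (hv : v ∈ C) (t : ℕ) :
    2 * α t * (ρ * (lpNorm 1 (iter η γ ρ n C α x₀ y₀ z (t + 1)).1 - lpNorm 1 v)) +
      2 * α t * inner ℝ (mul (sampleMatrix η γ (z t))ᵀ (iter η γ ρ n C α x₀ y₀ z t).2)
        ((iter η γ ρ n C α x₀ y₀ z t).1 - v) ≤
      ‖(iter η γ ρ n C α x₀ y₀ z t).1 - v‖ ^ 2 - ‖(iter η γ ρ n C α x₀ y₀ z (t + 1)).1 - v‖ ^ 2 -
      ‖(iter η γ ρ n C α x₀ y₀ z t).1 - (iter η γ ρ n C α x₀ y₀ z (t + 1)).1‖ ^ 2 +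
      2 * α t * inner ℝ (mul (sampleMatrix η γ (z t))ᵀ (iter η γ ρ n C α x₀ y₀ z t).2)
        ((iter η γ ρ n C α x₀ y₀ z t).1 - (iter η γ ρ n C α x₀ y₀ z (t + 1)).1) := by
  have h := proximal_step_le (convexOn_const_mul_lpNorm_one hCc (hα t).le hρ)
    (proxOn_lpNorm_mem hC ⟨v, hv⟩ (hα t).le hρ ((iter η γ ρ n C α x₀ y₀ z t).1 - α t •
      mul (sampleMatrix η γ (z t))ᵀ (iter η γ ρ n C α x₀ y₀ z t).2)) hv
  simp only [iter]
  linarith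

omit hρ hα hC hCc in
lemma step_snd [Fact (1 ≤ n)] {u : Vec d} (hu : u ∈ dualBall d n) (t : ℕ) :
    -(2 * α t * inner ℝ (mul (sampleMatrix η γ (z t)) (iter η γ ρ n C α x₀ y₀ z t).1 -
        sampleVector η (z t)) ((iter η γ ρ n C α x₀ y₀ z t).2 - u)) ≤
      ‖(iter η γ ρ n C α x₀ y₀ z t).2 - u‖ ^ 2 - ‖(iter η γ ρ n C α x₀ y₀ z (t + 1)).2 - u‖ ^ 2 +
      α t ^ 2 * ‖mul (sampleMatrix η γ (z t)) (iter η γ ρ n C α x₀ y₀ z t).1 -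
        sampleVector η (z t)‖ ^ 2 := by
  set p := iter η γ ρ n C α x₀ y₀ z t with hp
  set g := mul (sampleMatrix η γ (z t)) p.1 - sampleVector η (z t) with hg
  -- Ascent is the proximal step for f = 0 with step size -α_t.
  have h1 := projBall_mem_argminOn (n := n) (p.2 - (-α t) • g)
  have h := proximal_step_le (convexOn_const 0 (convex_dualBall n)) h1 hu
  have e : (iter η γ ρ n C α x₀ y₀ z (t + 1)).2 = projBall n (p.2 - (-α t) • g) := by
    simp only [iter, neg_smul, sub_neg_eq_add, ← hp, ← hg]
  have h2 := two_mul_inner_sub_sq_le (-α t) g (p.2 - projBall n (p.2 - (-α t) • g))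
  rw [e]
  rw [neg_sq] at h2
  linarith

variable [Fact (1 ≤ n)] (hL : SubgradBound η γ ρ n C α x₀ y₀ z L)
include hL

/-- Gap of the sampled saddle functions for non-increasing step sizes. -/
lemma sum_sampleGap_le_of_antitone (hanti : Antitone α) {v u : Vec d} (hv : v ∈ C)
    (hu : u ∈ dualBall d n) (t : ℕ) :
    ∑ i ∈ Finset.range t, α i * sampleGap η γ ρ n C α x₀ y₀ z v u i ≤
      (‖x₀ - v‖ ^ 2 + ‖y₀ - u‖ ^ 2 + 2 * α 0 * ρ * lpNorm 1 x₀) / 2 +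
        (∑ i ∈ Finset.range t, α i ^ 2) * L ^ 2 := by
  -- The potential 2 α_t ρ ‖x_t‖₁ compensates for the regularizer being evaluated one step late. It
  -- telescopes because α_{t+1} ≤ α_t, and its initial value is the source of 2 α_0 ρ ‖x_0‖₁.
  have key : 2 * ∑ i ∈ Finset.range t, α i * sampleGap η γ ρ n C α x₀ y₀ z v u i +
      sqDist η γ ρ n C α x₀ y₀ z v u t +
      2 * α t * (ρ * lpNorm 1 (iter η γ ρ n C α x₀ y₀ z t).1) ≤
      ‖x₀ - v‖ ^ 2 + ‖y₀ - u‖ ^ 2 + 2 * α 0 * (ρ * lpNorm 1 x₀) +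
        2 * (∑ i ∈ Finset.range t, α i ^ 2) * L ^ 2 := by
    induction t with
    | zero => simp [sqDist, iter]
    | succ t ih =>
      have h1 := step_fst (η := η) (γ := γ) (n := n) (x₀ := x₀) (y₀ := y₀) (z := z)
        hρ hα hC hCc hv t
      have h2 := step_snd (η := η) (γ := γ) (ρ := ρ) (C := C) (α := α) (x₀ := x₀) (y₀ := y₀)
        (z := z) hu t
      have h3 := two_mul_inner_sub_sq_le (α t)
        (mul (sampleMatrix η γ (z t))ᵀ (iter η γ ρ n C α x₀ y₀ z t).2)
        ((iter η γ ρ n C α x₀ y₀ z t).1 - (iter η γ ρ n C α x₀ y₀ z (t + 1)).1)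
      have h4 := mul_le_mul_of_nonneg_left
        (pow_le_pow_left₀ (norm_nonneg _) (hL t).1 2) (sq_nonneg (α t))
      have h5 := mul_le_mul_of_nonneg_left
        (pow_le_pow_left₀ (norm_nonneg _) (hL t).2 2) (sq_nonneg (α t))
      have h6 := mul_le_mul_of_nonneg_right (hanti (Nat.le_succ t))
        (mul_nonneg hρ (lpNorm_nonneg 1 (iter η γ ρ n C α x₀ y₀ z (t + 1)).1))
      simp only [Finset.sum_range_succ, sqDist, sampleGap, saddle_sub_saddle] at ih ⊢
      rw [Nat.succ_eq_add_one] at h6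
      linarith
  have h7 := mul_nonneg (hα t).le
    (mul_nonneg hρ (lpNorm_nonneg 1 (iter η γ ρ n C α x₀ y₀ z t).1))
  have h8 : 0 ≤ sqDist η γ ρ n C α x₀ y₀ z v u t := by unfold sqDist; positivity
  linarith

/-- Gap of the sampled saddle functions for arbitrary step sizes. -/
lemma sum_sampleGap_le {v u : Vec d} (hv : v ∈ C) (hu : u ∈ dualBall d n) (t : ℕ) :
    ∑ i ∈ Finset.range t, α i * sampleGap η γ ρ n C α x₀ y₀ z v u i ≤
      (‖x₀ - v‖ ^ 2 + ‖y₀ - u‖ ^ 2) / 2 +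
        (∑ i ∈ Finset.range t, α i ^ 2) * (((L + ρ * (2 * d)) ^ 2 + L ^ 2) / 2) := by
  have key : 2 * ∑ i ∈ Finset.range t, α i * sampleGap η γ ρ n C α x₀ y₀ z v u i +
      sqDist η γ ρ n C α x₀ y₀ z v u t ≤
      ‖x₀ - v‖ ^ 2 + ‖y₀ - u‖ ^ 2 +
        (∑ i ∈ Finset.range t, α i ^ 2) * ((L + ρ * (2 * d)) ^ 2 + L ^ 2) := by
    induction t with
    | zero => simp [sqDist, iter]
    | succ t ih =>
      have h1 := step_fst (η := η) (γ := γ) (n := n) (x₀ := x₀) (y₀ := y₀) (z := z)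
        hρ hα hC hCc hv t
      have h2 := step_snd (η := η) (γ := γ) (ρ := ρ) (C := C) (α := α) (x₀ := x₀) (y₀ := y₀)
        (z := z) hu t
      have h5 := mul_le_mul_of_nonneg_left
        (pow_le_pow_left₀ (norm_nonneg _) (hL t).2 2) (sq_nonneg (α t))
      simp only [Finset.sum_range_succ, sqDist, sampleGap, saddle_sub_saddle] at ih ⊢
      set p := iter η γ ρ n C α x₀ y₀ z t with hp
      set q := iter η γ ρ n C α x₀ y₀ z (t + 1) with hq
      set g := mul (sampleMatrix η γ (z t))ᵀ p.2 with hg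
      -- Without monotone steps the shift of the regularizer is paid for by the Lipschitz constant
      -- 2d of the ℓ₁ norm, so the effective subgradient bound is L + 2dρ.
      have h3 : inner ℝ g (p.1 - q.1) + ρ * (lpNorm 1 p.1 - lpNorm 1 q.1) ≤
          (L + ρ * (2 * d)) * ‖p.1 - q.1‖ := by
        have a1 := real_inner_le_norm g (p.1 - q.1)
        have a2 := mul_le_mul_of_nonneg_right (hL t).1 (norm_nonneg (p.1 - q.1))
        have a3 := mul_le_mul_of_nonneg_left (lpNorm_one_sub_le p.1 q.1) hρ
        linarith
      have h4 := mul_le_mul_of_nonneg_left h3 (hα t).le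
      have h6 := sq_nonneg (α t * (L + ρ * (2 * d)) - ‖p.1 - q.1‖)
      linarith
  have h8 : 0 ≤ sqDist η γ ρ n C α x₀ y₀ z v u t := by unfold sqDist; positivity
  linarith

end Iterates
-- Mean-zero noise and a weighted strong law.
section Noise
variable {Ω : Type*} [mΩ : MeasurableSpace Ω] {P : Measure Ω} {F : ℕ → MeasurableSpace Ω}

/-- `ξ t` has mean zero given the past `F t`, tested against the bounded `F t`-measurable
functions. -/
def IsNoise (P : Measure Ω) (F : ℕ → MeasurableSpace Ω) (ξ : ℕ → Ω → ℝ) : Prop :=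
  ∀ (t : ℕ) (f : Ω → ℝ) (c : ℝ), Measurable[F t] f → (∀ᵐ ω ∂P, |f ω| ≤ c) →
    Integrable (fun ω => f ω * ξ t ω) P ∧ ∫ ω, f ω * ξ t ω ∂P = 0

lemma IsNoise.sum {ι : Type*} {s : Finset ι} {ξ : ι → ℕ → Ω → ℝ}
    (h : ∀ i ∈ s, IsNoise P F (ξ i)) : IsNoise P F fun t ω => ∑ i ∈ s, ξ i t ω := by
  intro t f c hf hc
  simp_rw [Finset.mul_sum]
  refine ⟨integrable_finsetSum _ fun i hi => (h i hi t f c hf hc).1, ?_⟩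
  rw [integral_finsetSum _ fun i hi => (h i hi t f c hf hc).1]
  exact Finset.sum_eq_zero fun i hi => (h i hi t f c hf hc).2

lemma IsNoise.sub {ξ ζ : ℕ → Ω → ℝ} (h : IsNoise P F ξ) (h' : IsNoise P F ζ) :
    IsNoise P F fun t ω => ξ t ω - ζ t ω := by
  intro t f c hf hc
  have h1 := h t f c hf hc
  have h2 := h' t f c hf hc
  simp_rw [mul_sub]
  exact ⟨h1.1.sub h2.1, by rw [integral_sub h1.1 h2.1, h1.2, h2.2, sub_zero]⟩

lemma IsNoise.integrable [IsFiniteMeasure P] {ξ : ℕ → Ω → ℝ} (h : IsNoise P F ξ) (t : ℕ) :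
    Integrable (ξ t) P := by
  simpa using (h t (fun _ => 1) 1 measurable_const (by simp)).1

lemma IsNoise.integral_eq_zero [IsFiniteMeasure P] {ξ : ℕ → Ω → ℝ} (h : IsNoise P F ξ) (t : ℕ) :
    ∫ ω, ξ t ω ∂P = 0 := by
  simpa using (h t (fun _ => 1) 1 measurable_const (by simp)).2

/-- The information carried by the samples before time `t`. -/
abbrev history {S : Type*} [MeasurableSpace S] (Z : ℕ → Ω → S) (t : ℕ) : MeasurableSpace Ω :=
  ⨆ s ∈ Set.Iio t, MeasurableSpace.comap (Z s) inferInstance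

section History
variable {S : Type*} [MeasurableSpace S] {Z : ℕ → Ω → S}

omit mΩ in
lemma history_mono : Monotone (history Z) := fun _ _ h =>
  biSup_mono fun _ hs => lt_of_lt_of_le hs h

lemma history_le (hZ : ∀ t, Measurable (Z t)) (t : ℕ) : history Z t ≤ mΩ :=
  iSup₂_le fun s _ => (hZ s).comap_le

omit mΩ in
lemma measurable_history_succ (t : ℕ) : Measurable[history Z (t + 1)] (Z t) := by
  rw [measurable_iff_comap_le]
  exact le_iSup₂_of_le (f := fun s (_ : s ∈ Set.Iio (t + 1)) =>
    MeasurableSpace.comap (Z s) inferInstance) t (Nat.lt_succ_self t) le_rfl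

lemma indep_history (hZ : ∀ t, Measurable (Z t)) (hind : iIndepFun Z P) (t : ℕ) :
    Indep (history Z t) (MeasurableSpace.comap (Z t) inferInstance) P := by
  have h := indep_iSup_of_disjoint (fun i => (hZ i).comap_le) hind
    (S := Set.Iio t) (T := {t}) (by simp)
  simpa [history] using h

/-- The product of the test function and c t depends only on the past, hence is independent of Z t,
and the expectation factors through the centred variable. Only integrability of θ is needed. -/
lemma isNoise_mul_sub_integral [IsProbabilityMeasure P] (hZ : ∀ t, Measurable (Z t))
    (hind : iIndepFun Z P) (hid : ∀ t, IdentDistrib (Z t) (Z 0) P P) {θ : S → ℝ}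
    (hθ : Measurable θ) (hint : Integrable (fun ω => θ (Z 0 ω)) P) {c : ℕ → Ω → ℝ}
    (hc : ∀ t, Measurable[history Z t] (c t)) {K : ℝ} (hK : ∀ t, ∀ᵐ ω ∂P, |c t ω| ≤ K) :
    IsNoise P (history Z) fun t ω => c t ω * (θ (Z t ω) - ∫ ω', θ (Z 0 ω') ∂P) := by
  intro t f B hf hB
  have hidt : IdentDistrib (fun ω => θ (Z t ω)) (fun ω => θ (Z 0 ω)) P P := (hid t).comp hθ
  have hintt : Integrable (fun ω => θ (Z t ω)) P := hidt.integrable_iff.2 hint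
  set e := ∫ ω', θ (Z 0 ω') ∂P with he
  have hX : Integrable (fun ω => θ (Z t ω) - e) P := hintt.sub (integrable_const _)
  have hX0 : ∫ ω, (θ (Z t ω) - e) ∂P = 0 := by
    rw [integral_sub hintt (integrable_const _), hidt.integral_eq]
    simp [he]
  have hfc : Measurable[history Z t] fun ω => f ω * c t ω := hf.mul (hc t)
  have hfc' : Measurable fun ω => f ω * c t ω := hfc.mono (history_le hZ t) le_rfl
  have hfci : Integrable (fun ω => f ω * c t ω) P := by
    refine Integrable.of_bound hfc'.aestronglyMeasurable (B * K) ?_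
    filter_upwards [hB, hK t] with ω h1 h2
    rw [Real.norm_eq_abs, abs_mul]
    exact mul_le_mul h1 h2 (abs_nonneg _) ((abs_nonneg _).trans h1)
  have hindep : IndepFun (fun ω => f ω * c t ω) (fun ω => θ (Z t ω) - e) P := by
    rw [IndepFun_iff_Indep]
    refine indep_of_indep_of_le_left (indep_of_indep_of_le_right (indep_history hZ hind t) ?_)
      hfc.comap_le
    rw [← measurable_iff_comap_le]
    exact (hθ.sub_const e).comp (comap_measurable (Z t))
  simp_rw [← mul_assoc]
  refine ⟨hindep.integrable_mul hfci hX, ?_⟩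
  rw [hindep.integral_fun_mul_eq_mul_integral hfci.aestronglyMeasurable hX.aestronglyMeasurable,
    hX0, mul_zero]

end History

section Sums
variable [IsProbabilityMeasure P] (hF : Monotone F) (hFle : ∀ t, F t ≤ mΩ) {ξ : ℕ → Ω → ℝ}
  (hξ : ∀ t, Measurable[F (t + 1)] (ξ t)) {K : ℝ} (hK : ∀ t, ∀ᵐ ω ∂P, |ξ t ω| ≤ K)
  (hN : IsNoise P F ξ) {α : ℕ → ℝ} (hα : ∀ t, 0 < α t) {B : ℝ} (hB : ∀ t, α t ≤ B)

omit mΩ in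
include hF hξ in
lemma measurable_weighted_sum (t : ℕ) :
    Measurable[F t] fun ω => ∑ i ∈ Finset.range t, α i * ξ i ω := by
  refine Finset.measurable_sum _ fun i hi => ?_
  exact ((hξ i).const_mul (α i)).mono (hF (Finset.mem_range.1 hi)) le_rfl

omit [IsProbabilityMeasure P] in
include hK hα in
lemma abs_weighted_sum_sub_le : ∀ᵐ ω ∂P, ∀ s t, s ≤ t →
    |∑ i ∈ Finset.range t, α i * ξ i ω - ∑ i ∈ Finset.range s, α i * ξ i ω| ≤
      K * (∑ i ∈ Finset.range t, α i - ∑ i ∈ Finset.range s, α i) := by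
  filter_upwards [ae_all_iff.2 hK] with ω hω s t hst
  rw [← Finset.sum_Ico_eq_sub _ hst, ← Finset.sum_Ico_eq_sub _ hst, Finset.mul_sum]
  refine (Finset.abs_sum_le_sum_abs _ _).trans (Finset.sum_le_sum fun i _ => ?_)
  rw [abs_mul, abs_of_pos (hα i), mul_comm]
  exact mul_le_mul_of_nonneg_right (hω i) (hα i).le

include hF hFle hξ hK hN hα hB in
-- The increments are orthogonal: the partial sum is an admissible bounded test function, so the
-- cross term vanishes. Each step adds at most α_t² K² ≤ K² B α_t, hence growth linear in the sum of
-- the steps.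
lemma integral_sq_weighted_sum_le (t : ℕ) :
    Integrable (fun ω => (∑ i ∈ Finset.range t, α i * ξ i ω) ^ 2) P ∧
    ∫ ω, (∑ i ∈ Finset.range t, α i * ξ i ω) ^ 2 ∂P ≤
      K ^ 2 * B * ∑ i ∈ Finset.range t, α i := by
  induction t with
  | zero => simp
  | succ t ih =>
    set M := fun ω => ∑ i ∈ Finset.range t, α i * ξ i ω with hM
    have hbd : ∀ᵐ ω ∂P, |M ω| ≤ K * ∑ i ∈ Finset.range t, α i := by
      filter_upwards [abs_weighted_sum_sub_le hK hα] with ω hω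
      simpa [hM] using hω 0 t (Nat.zero_le t)
    obtain ⟨h1, h2⟩ := hN t M _ (measurable_weighted_sum hF hξ t) hbd
    have hsq : Integrable (fun ω => ξ t ω ^ 2) P := by
      refine Integrable.of_bound
        (((hξ t).mono (hFle _) le_rfl).pow_const 2).aestronglyMeasurable (K ^ 2) ?_
      filter_upwards [hK t] with ω hω
      rw [Real.norm_eq_abs, abs_pow]
      exact pow_le_pow_left₀ (abs_nonneg _) hω 2
    have hsq' : ∫ ω, ξ t ω ^ 2 ∂P ≤ K ^ 2 := by
      have : ∫ ω, ξ t ω ^ 2 ∂P ≤ ∫ _ω, K ^ 2 ∂P := by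
        refine integral_mono_ae hsq (integrable_const _) ?_
        filter_upwards [hK t] with ω hω
        exact sq_le_sq' (abs_le.1 hω).1 (abs_le.1 hω).2
      simpa using this
    have e : ∀ ω, (∑ i ∈ Finset.range (t + 1), α i * ξ i ω) ^ 2 =
        M ω ^ 2 + 2 * α t * (M ω * ξ t ω) + α t ^ 2 * ξ t ω ^ 2 := fun ω => by
      rw [Finset.sum_range_succ]; ring
    simp_rw [e]
    have i1 := ih.1.add (h1.const_mul (2 * α t))
    have i2 := hsq.const_mul (α t ^ 2)
    refine ⟨i1.add i2, ?_⟩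
    have e1 := integral_add i1 i2
    have e2 := integral_add ih.1 (h1.const_mul (2 * α t))
    simp only [Pi.add_apply, integral_const_mul, h2, mul_zero, add_zero] at e1 e2
    rw [e1, e2, Finset.sum_range_succ]
    have h3 := mul_le_mul_of_nonneg_left hsq' (sq_nonneg (α t))
    have h4 := mul_le_mul_of_nonneg_left (hB t) (mul_nonneg (sq_nonneg K) (hα t).le)
    have h5 := ih.2
    linarith

include hF hFle hξ hK hN hα hB in
/-- A strong law of large numbers for weighted sums of bounded noise. -/
lemma ae_tendsto_weighted_average
    (hS : Tendsto (fun t => ∑ i ∈ Finset.range t, α i) atTop atTop) :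
    ∀ᵐ ω ∂P, Tendsto (fun t => (∑ i ∈ Finset.range t, α i * ξ i ω) / ∑ i ∈ Finset.range t, α i)
      atTop (𝓝 0) := by
  classical
  set S := fun t => ∑ i ∈ Finset.range t, α i with hSdef
  set M := fun t ω => ∑ i ∈ Finset.range t, α i * ξ i ω with hM
  have hSmono : Monotone S := monotone_nat_of_le_succ fun t => by
    simp only [hSdef, Finset.sum_range_succ]; linarith [hα t]
  have hB0 : 0 ≤ B := (hα 0).le.trans (hB 0)
  have hex : ∀ k : ℕ, ∃ t, ((k : ℝ) + 1) ^ 2 ≤ S t := fun k => (hS.eventually_ge_atTop _).exists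
  -- Quadratic spacing makes the second moment of the average at time τ k at most K² B / (k + 1)²,
  -- which is summable.
  let τ : ℕ → ℕ := fun k => Nat.find (hex k)
  have hτ : ∀ k : ℕ, ((k : ℝ) + 1) ^ 2 ≤ S (τ k) := fun k => Nat.find_spec (hex k)
  have hτ' : ∀ (k t : ℕ), ((k : ℝ) + 1) ^ 2 ≤ S t → τ k ≤ t := fun k t h => Nat.find_min' (hex k) h
  have hSpos : ∀ k, 0 < S (τ k) := fun k => lt_of_lt_of_le (by positivity) (hτ k)
  -- the averages converge along the times `τ k`
  have hsub : ∀ᵐ ω ∂P, Tendsto (fun k => (M (τ k) ω / S (τ k)) ^ 2) atTop (𝓝 0) := by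
    have hmeas : ∀ k, Measurable fun ω => (M (τ k) ω / S (τ k)) ^ 2 := fun k =>
      (((measurable_weighted_sum hF hξ (τ k)).mono (hFle _) le_rfl).div_const _).pow_const 2
    have hle : ∀ k : ℕ, ∫⁻ ω, ENNReal.ofReal ((M (τ k) ω / S (τ k)) ^ 2) ∂P ≤
        ENNReal.ofReal (K ^ 2 * B * (1 / ((k + 1 : ℕ) : ℝ) ^ 2)) := fun k => by
      obtain ⟨h1, h2⟩ := integral_sq_weighted_sum_le hF hFle hξ hK hN hα hB (τ k)
      have h3 : Integrable (fun ω => (M (τ k) ω / S (τ k)) ^ 2) P := by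
        simp_rw [div_pow]; exact h1.div_const _
      rw [← ofReal_integral_eq_lintegral_ofReal h3 (ae_of_all _ fun ω => sq_nonneg _)]
      refine ENNReal.ofReal_le_ofReal ?_
      simp_rw [div_pow]
      rw [integral_div, div_le_iff₀ (pow_pos (hSpos k) 2)]
      refine h2.trans ?_
      rw [mul_assoc (K ^ 2 * B)]
      refine mul_le_mul_of_nonneg_left ?_ (by positivity)
      push_cast
      rw [div_mul_eq_mul_div, one_mul, le_div_iff₀ (by positivity), sq (∑ i ∈ _, α i)]
      exact mul_le_mul_of_nonneg_left (hτ k) (hSpos k).le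
    have hsum : ∑' k : ℕ, ENNReal.ofReal (K ^ 2 * B * (1 / ((k + 1 : ℕ) : ℝ) ^ 2)) ≠ ⊤ := by
      refine Summable.tsum_ofReal_ne_top (Summable.mul_left _ ?_)
      exact (summable_nat_add_iff 1).2 (Real.summable_one_div_nat_pow.2 one_lt_two)
    -- By Tonelli the series of squared averages has finite expectation, so almost surely it
    -- converges and its terms tend to 0.
    have hfin : ∫⁻ ω, ∑' k, ENNReal.ofReal ((M (τ k) ω / S (τ k)) ^ 2) ∂P ≠ ⊤ := by
      rw [lintegral_tsum fun k => (hmeas k).ennreal_ofReal.aemeasurable]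
      exact ne_top_of_le_ne_top hsum (ENNReal.tsum_le_tsum hle)
    filter_upwards [ae_lt_top (Measurable.tsum fun k => (hmeas k).ennreal_ofReal) hfin]
      with ω hω
    have h := ENNReal.tendsto_atTop_zero_of_tsum_ne_top hω.ne
    have h' := (ENNReal.tendsto_toReal ENNReal.zero_ne_top).comp h
    simpa [Function.comp_def, ENNReal.toReal_ofReal, sq_nonneg] using h'
  filter_upwards [hsub, abs_weighted_sum_sub_le hK hα, hK 0] with ω h1 h2 hK0
  have hKnn : 0 ≤ K := (abs_nonneg _).trans hK0
  have habs : Tendsto (fun k => |M (τ k) ω / S (τ k)|) atTop (𝓝 0) := by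
    have := (Real.continuous_sqrt.tendsto 0).comp h1
    simpa [Function.comp_def, Real.sqrt_sq_eq_abs] using this
  -- the index of the last time `τ k` before `t`
  let κ : ℕ → ℕ := fun t => ⌊√(S t)⌋₊ - 1
  have hκ : Tendsto κ atTop atTop :=
    (tendsto_sub_atTop_nat 1).comp (tendsto_nat_floor_atTop.comp (Real.tendsto_sqrt_atTop.comp hS))
  -- Between τ k and the times t with κ t = k, the sum S grows by at most (k + 2)² - (k + 1)² = 2k +
  -- 3, while S t ≥ (k + 1)².
  have hrate : Tendsto (fun k : ℕ => K * ((2 * (k : ℝ) + 3) / ((k : ℝ) + 1) ^ 2)) atTop (𝓝 0) := by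
    have h3 : Tendsto (fun k : ℕ => K * (3 * (1 / ((k : ℝ) + 1)))) atTop (𝓝 (K * (3 * 0))) :=
      (tendsto_one_div_add_atTop_nhds_zero_nat.const_mul 3).const_mul K
    simp only [mul_zero] at h3
    refine squeeze_zero (fun k => by positivity) (fun k => ?_) h3
    refine mul_le_mul_of_nonneg_left ?_ hKnn
    rw [mul_one_div, div_le_div_iff₀ (by positivity) (by positivity)]
    nlinarith [Nat.cast_nonneg (α := ℝ) k, sq_nonneg (k : ℝ)]
  have hlim := (habs.comp hκ).add (hrate.comp hκ)
  rw [add_zero] at hlim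
  refine squeeze_zero_norm' ?_ hlim
  filter_upwards [hS.eventually_ge_atTop 1] with t ht
  -- Since S t ≥ 1, the truncated subtraction in κ is exact, and κ t + 1 is the integer part of √(S
  -- t).
  have hfl : 1 ≤ ⌊√(S t)⌋₊ := Nat.le_floor (by simpa using ht)
  have hκt : ((κ t : ℝ) + 1) = (⌊√(S t)⌋₊ : ℝ) := by
    have : κ t + 1 = ⌊√(S t)⌋₊ := Nat.sub_add_cancel hfl
    exact_mod_cast this
  have hS0 : 0 ≤ S t := zero_le_one.trans ht
  have hlow : ((κ t : ℝ) + 1) ^ 2 ≤ S t := by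
    rw [hκt, ← Real.le_sqrt (Nat.cast_nonneg _) hS0]
    exact Nat.floor_le (Real.sqrt_nonneg _)
  have hupp : S t ≤ ((κ t : ℝ) + 1 + 1) ^ 2 := by
    rw [hκt, ← Real.sqrt_le_left (by positivity)]
    exact (Nat.lt_floor_add_one _).le
  have hle := hτ' _ _ hlow
  have h4 := h2 _ _ hle
  have h5 := hτ (κ t)
  have hSt : 0 < S t := by linarith
  change |M t ω / S t| ≤ |M (τ (κ t)) ω / S (τ (κ t))| +
    K * ((2 * (κ t : ℝ) + 3) / ((κ t : ℝ) + 1) ^ 2)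
  have h6 : |M t ω| ≤ |M (τ (κ t)) ω| + K * (2 * (κ t : ℝ) + 3) := by
    have a1 := abs_sub_abs_le_abs_sub (M t ω) (M (τ (κ t)) ω)
    have a2 : K * (S t - S (τ (κ t))) ≤ K * (2 * (κ t : ℝ) + 3) :=
      mul_le_mul_of_nonneg_left (by linarith) hKnn
    linarith [h4]
  rw [abs_div, abs_of_pos hSt, abs_div, abs_of_pos (hSpos _)]
  calc |M t ω| / S t ≤ (|M (τ (κ t)) ω| + K * (2 * (κ t : ℝ) + 3)) / S t :=
        div_le_div_of_nonneg_right h6 hSt.le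
    _ = |M (τ (κ t)) ω| / S t + K * (2 * (κ t : ℝ) + 3) / S t := add_div _ _ _
    _ ≤ |M (τ (κ t)) ω| / S (τ (κ t)) + K * (2 * (κ t : ℝ) + 3) / ((κ t : ℝ) + 1) ^ 2 := by
        gcongr
        · exact hSpos _
        · exact hSmono hle
    _ = _ := by rw [mul_div_assoc]

end Sums
end Noise

/-! ### Weighted Cesàro means. -/

section WeightedAverage

/-- Weighted averages of a convergent sequence. -/
lemma tendsto_sum_mul_div_sum {α c : ℕ → ℝ} {a : ℝ} (hα : ∀ t, 0 ≤ α t)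
    (hS : Tendsto (fun t => ∑ i ∈ Finset.range t, α i) atTop atTop)
    (hc : Tendsto c atTop (𝓝 a)) :
    Tendsto (fun t => (∑ i ∈ Finset.range t, α i * c i) / ∑ i ∈ Finset.range t, α i) atTop
      (𝓝 a) := by
  have h0 : (fun i => α i * (c i - a)) =o[atTop] α := by
    have h1 : (fun i => c i - a) =o[atTop] fun _ => (1 : ℝ) := by
      rw [Asymptotics.isLittleO_one_iff]
      simpa using hc.sub_const a
    simpa using (Asymptotics.isBigO_refl α atTop).mul_isLittleO h1
  have h2 := (h0.sum_range hα hS).tendsto_div_nhds_zero.add_const a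
  rw [zero_add] at h2
  refine h2.congr' ?_
  filter_upwards [hS.eventually_gt_atTop 0] with t ht
  simp_rw [mul_sub, Finset.sum_sub_distrib, ← Finset.sum_mul]
  field_simp
  ring

end WeightedAverage
-- Measurability of the iterates.
section Measurability
variable {d : ℕ} (η γ : ℝ)

lemma continuous_sampleMatrix : Continuous (sampleMatrix (d := d) η γ) := by
  have h1 : Continuous fun z : Sample d => z.1 := continuous_fst
  have h2 : Continuous fun z : Sample d => z.2.2 := continuous_snd.snd
  have h3 : Continuous fun z : Sample d => z.1 - γ • z.2.2 := h1.sub (h2.const_smul γ)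
  exact ((h1.matrix_vecMulVec h1).const_smul η).matrix_fromBlocks
    ((h1.matrix_vecMulVec h3).const_smul η) ((h2.matrix_vecMulVec h1).const_smul γ)
    (h1.matrix_vecMulVec h3)

lemma continuous_sampleVector : Continuous (sampleVector (d := d) η) := by
  refine (PiLp.continuous_toLp 2 _).comp (continuous_pi fun i => ?_)
  have h1 : Continuous fun z : Sample d => z.1 := continuous_fst
  have h2 : Continuous fun z : Sample d => z.2.1 := continuous_snd.fst
  cases i with
  | inl i => exact (continuous_apply i).comp ((h2.const_mul η).smul h1)
  | inr i => exact (continuous_apply i).comp (h2.smul h1)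

lemma continuous_residual : Continuous fun p : Sample d × Vec d =>
    mul (sampleMatrix η γ p.1) p.2 - sampleVector η p.1 :=
  (continuous_mul.comp (((continuous_sampleMatrix η γ).comp continuous_fst).prodMk
    continuous_snd)).sub ((continuous_sampleVector η).comp continuous_fst)

lemma continuous_transpose_mul : Continuous fun p : Sample d × Vec d =>
    mul (sampleMatrix η γ p.1)ᵀ p.2 :=
  continuous_mul.comp (((continuous_sampleMatrix η γ).comp continuous_fst).matrix_transpose.prodMk
    continuous_snd)

/-- Each update is continuous in the current sample and iterate, so the iterate at time t is a
function of the samples strictly before t. This is the source of its independence from Z t. -/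
lemma measurable_iter {Ω : Type*} {ρ : ℝ} {n : ENNReal} [Fact (1 ≤ n)] {C : Set (Vec d)}
    {α : ℕ → ℝ} {x₀ y₀ : Vec d} (hρ : 0 ≤ ρ) (hα : ∀ t, 0 < α t) (hC : IsClosed C)
    (hCc : Convex ℝ C) (hne : C.Nonempty) (Z : ℕ → Ω → Sample d) (t : ℕ) :
    Measurable[history Z t] fun ω => iter η γ ρ n C α x₀ y₀ (fun s => Z s ω) t := by
  induction t with
  | zero => exact measurable_const
  | succ t ih =>
    have hp := ih.mono (history_mono (Nat.le_succ t)) le_rfl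
    have hz := measurable_history_succ (Z := Z) t
    have h1 := (continuous_proxOn hC hne (((continuous_lpNorm 1).const_mul ρ).const_mul (α t))
      (fun z => mul_nonneg (hα t).le (mul_nonneg hρ (lpNorm_nonneg 1 z)))
      (convexOn_const_mul_lpNorm_one hCc (hα t).le hρ)).measurable
    have h2 : Measurable (projBall (d := d) n) :=
      (continuous_proxOn (isClosed_dualBall n) ⟨0, zero_mem_dualBall n⟩ continuous_const
        (fun _ => le_rfl) (convexOn_const 0 (convex_dualBall n))).measurable
    have h3 := (continuous_transpose_mul (d := d) η γ).measurable.comp (hz.prodMk hp.snd)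
    have h4 := (continuous_residual (d := d) η γ).measurable.comp (hz.prodMk hp.fst)
    exact (h1.comp (hp.fst.sub (h3.const_smul (α t)))).prodMk
      (h2.comp (hp.snd.add (h4.const_smul (α t))))

end Measurability

/-! ### Sampling errors of the saddle function. -/

section SamplingNoise
variable {d : ℕ} {Ω : Type*} [mΩ : MeasurableSpace Ω] {P : Measure Ω} [IsProbabilityMeasure P]
  {η γ : ℝ} {Z : ℕ → Ω → Sample d} {A : Matrix (Fin d ⊕ Fin d) (Fin d ⊕ Fin d) ℝ} {b : Vec d}
  {x y : ℕ → Ω → Vec d}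

variable (η γ Z A b x y)

/-- The error of the sampled residual `A_t x_t - b_t`. -/
noncomputable def residualNoise (k : Fin d ⊕ Fin d) (t : ℕ) (ω : Ω) : ℝ :=
  (mul (sampleMatrix η γ (Z t ω)) (x t ω) - sampleVector η (Z t ω)) k - (mul A (x t ω) - b) k

/-- The error of the sampled gradient `A_tᵀ y_t`. -/
noncomputable def gradientNoise (k : Fin d ⊕ Fin d) (t : ℕ) (ω : Ω) : ℝ :=
  mul (sampleMatrix η γ (Z t ω))ᵀ (y t ω) k - mul Aᵀ (y t ω) k

/-- The error of the sampled linear term `y_tᵀ b_t`. -/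
noncomputable def offsetNoise (t : ℕ) (ω : Ω) : ℝ :=
  inner ℝ (y t ω) (sampleVector η (Z t ω)) - inner ℝ (y t ω) b

/-- The difference of the sampled and the exact gap. -/
noncomputable def gapNoise (v u : Vec d) (t : ℕ) (ω : Ω) : ℝ :=
  (∑ k, u k * residualNoise η γ Z A b x k t ω) - (∑ k, v k * gradientNoise η γ Z A y k t ω) +
    offsetNoise η Z b y t ω

variable {η γ Z A b x y}

lemma inner_eq_sum (v w : Vec d) : inner ℝ v w = ∑ k, v k * w k := by
  rw [← dot_eq_inner]; rfl

omit mΩ in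
-- The regularizer cancels, and what remains is affine in (v, u), which reduces uniformity over
-- reference pairs to finitely many scalar noises.
lemma saddle_sub_saddle_eq_add_gapNoise (ρ : ℝ) (v u : Vec d) (t : ℕ) (ω : Ω) :
    saddle ρ (sampleMatrix η γ (Z t ω)) (sampleVector η (Z t ω)) (x t ω) u -
      saddle ρ (sampleMatrix η γ (Z t ω)) (sampleVector η (Z t ω)) v (y t ω) =
    saddle ρ A b (x t ω) u - saddle ρ A b v (y t ω) + gapNoise η γ Z A b x y v u t ω := by
  simp only [gapNoise, residualNoise, gradientNoise, offsetNoise, mul_sub,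
    Finset.sum_sub_distrib, ← inner_eq_sum, saddle_eq]
  rw [real_inner_comm _ v, real_inner_comm _ v, inner_mul_transpose, inner_mul_transpose]
  simp only [inner_sub_right]
  ring

variable (hZm : ∀ t, Measurable (Z t)) (hZind : iIndepFun Z P)
  (hZid : ∀ t, IdentDistrib (Z t) (Z 0) P P)
  (hAint : ∀ i j, Integrable (fun ω => sampleMatrix η γ (Z 0 ω) i j) P)
  (hbint : ∀ i, Integrable (fun ω => sampleVector η (Z 0 ω) i) P)
  (hA : A = meanMatrix P η γ (Z 0)) (hb : b = meanVector P η (Z 0))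
  (hxm : ∀ t, Measurable[history Z t] (x t)) (hym : ∀ t, Measurable[history Z t] (y t))
  {R L : ℝ} (hxR : ∀ t, ∀ᵐ ω ∂P, ‖x t ω‖ ≤ R) (hyR : ∀ t, ∀ᵐ ω ∂P, ‖y t ω‖ ≤ R)
  (hLx : ∀ t, ∀ᵐ ω ∂P, ‖mul (sampleMatrix η γ (Z t ω))ᵀ (y t ω)‖ ≤ L)
  (hLy : ∀ t, ∀ᵐ ω ∂P, ‖mul (sampleMatrix η γ (Z t ω)) (x t ω) - sampleVector η (Z t ω)‖ ≤ L)

include hZm hZind hZid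

include hAint hA in
lemma isNoise_coord_mul_matrix {w : ℕ → Ω → Vec d} (hwm : ∀ t, Measurable[history Z t] (w t))
    (hwR : ∀ t, ∀ᵐ ω ∂P, ‖w t ω‖ ≤ R) (i j l : Fin d ⊕ Fin d) :
    IsNoise P (history Z) fun t ω => w t ω l * (sampleMatrix η γ (Z t ω) i j - A i j) := by
  subst hA
  refine isNoise_mul_sub_integral (θ := fun z => sampleMatrix η γ z i j) hZm hZind hZid
    ((continuous_sampleMatrix η γ).matrix_elem i j).measurable (hAint i j) (K := R)
    (fun t => (PiLp.continuous_apply 2 (fun _ => ℝ) l).measurable.comp (hwm t)) fun t => ?_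
  filter_upwards [hwR t] with ω hω
  exact (PiLp.norm_apply_le (w t ω) l).trans hω

include hbint hb in
lemma isNoise_mul_vector {c : ℕ → Ω → ℝ} (hc : ∀ t, Measurable[history Z t] (c t))
    (hcR : ∀ t, ∀ᵐ ω ∂P, |c t ω| ≤ R) (i : Fin d ⊕ Fin d) :
    IsNoise P (history Z) fun t ω => c t ω * (sampleVector η (Z t ω) i - b i) := by
  subst hb
  exact isNoise_mul_sub_integral (θ := fun z => sampleVector η z i) hZm hZind hZid
    ((PiLp.continuous_apply 2 (fun _ => ℝ) i).comp (continuous_sampleVector η)).measurable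
    (hbint i) hc hcR

include hAint hbint hA hb hxm hxR in
-- The entries of A_t and b_t are merely integrable, so the strong law is not applied to them one by
-- one. They serve to show mean zero; boundedness holds only for the combined residual, through L.
lemma isNoise_residualNoise (k : Fin d ⊕ Fin d) :
    IsNoise P (history Z) (residualNoise η γ Z A b x k) := by
  have h1 := IsNoise.sum (s := Finset.univ) fun l _ =>
    isNoise_coord_mul_matrix hZm hZind hZid hAint hA hxm hxR k l l
  have h2 := isNoise_mul_vector hZm hZind hZid hbint hb (c := fun _ _ => 1) (R := 1)
    (fun _ => measurable_const) (by simp) k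
  have h3 := h1.sub h2
  convert h3 using 3 with t ω
  simp only [residualNoise, mul, Matrix.mulVec, dotProduct, PiLp.sub_apply, mul_sub,
    Finset.sum_sub_distrib, one_mul]
  simp only [mul_comm (x t ω _)]
  ring

include hAint hA hym hyR in
lemma isNoise_gradientNoise (k : Fin d ⊕ Fin d) :
    IsNoise P (history Z) (gradientNoise η γ Z A y k) := by
  have h1 := IsNoise.sum (s := Finset.univ) fun l _ =>
    isNoise_coord_mul_matrix hZm hZind hZid hAint hA hym hyR l k l
  convert h1 using 3 with t ω
  simp only [gradientNoise, mul, Matrix.mulVec, dotProduct, mul_sub, Matrix.transpose_apply,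
    Finset.sum_sub_distrib]
  simp only [mul_comm (y t ω _)]

include hbint hb hym hyR in
lemma isNoise_offsetNoise : IsNoise P (history Z) (offsetNoise η Z b y) := by
  have h1 := IsNoise.sum (s := Finset.univ) fun l _ =>
    isNoise_mul_vector hZm hZind hZid hbint hb (c := fun t ω => y t ω l) (R := R)
      (fun t => (PiLp.continuous_apply 2 (fun _ => ℝ) l).measurable.comp (hym t))
      (fun t => (hyR t).mono fun ω hω => (PiLp.norm_apply_le (y t ω) l).trans hω) l
  convert h1 using 3 with t ω
  simp only [offsetNoise, inner_eq_sum, mul_sub, Finset.sum_sub_distrib]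

omit hZm hZind hZid [IsProbabilityMeasure P] in
lemma exists_bound_of_norm_le {f : Vec d → ℝ} (hf : Continuous f) (R : ℝ) :
    ∃ K, ∀ v, ‖v‖ ≤ R → |f v| ≤ K := by
  obtain ⟨K, hK⟩ := (isCompact_closedBall (0 : Vec d) R).exists_bound_of_continuousOn
    hf.continuousOn
  exact ⟨K, fun v hv => hK v (by simpa using hv)⟩

omit hZm hZind hZid in
lemma continuous_mul_const (B : Matrix (Fin d ⊕ Fin d) (Fin d ⊕ Fin d) ℝ) :
    Continuous fun v : Vec d => mul B v :=
  continuous_mul.comp (continuous_const.prodMk continuous_id)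

variable {α : ℕ → ℝ} (hα : ∀ t, 0 < α t) {B : ℝ} (hB : ∀ t, α t ≤ B)
  (hS : Tendsto (fun t => ∑ i ∈ Finset.range t, α i) atTop atTop)

include hα hB hS

include hAint hbint hA hb hxm hxR hLy in
lemma ae_tendsto_average_residualNoise (k : Fin d ⊕ Fin d) :
    ∀ᵐ ω ∂P, Tendsto (fun t => (∑ i ∈ Finset.range t, α i * residualNoise η γ Z A b x k i ω) /
      ∑ i ∈ Finset.range t, α i) atTop (𝓝 0) := by
  have hk : Continuous fun v : Vec d => v k := PiLp.continuous_apply 2 (fun _ => ℝ) k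
  have hc : Continuous fun v : Vec d => (mul A v - b) k :=
    hk.comp ((continuous_mul_const A).sub continuous_const)
  obtain ⟨K, hK⟩ := exists_bound_of_norm_le hc R
  refine ae_tendsto_weighted_average (K := L + K) history_mono (history_le hZm) (fun t => ?_)
    (fun t => ?_) (isNoise_residualNoise hZm hZind hZid hAint hbint hA hb hxm hxR k) hα hB hS
  · have hx' := (hxm t).mono (history_mono (Nat.le_succ t)) le_rfl
    have h1 := (continuous_residual (d := d) η γ).measurable.comp
      ((measurable_history_succ (Z := Z) t).prodMk hx')
    exact (hk.measurable.comp h1).sub (hc.measurable.comp hx')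
  · filter_upwards [hxR t, hLy t] with ω h1 h2
    exact (abs_sub _ _).trans (add_le_add ((PiLp.norm_apply_le _ k).trans h2) (hK _ h1))

include hAint hA hym hyR hLx in
lemma ae_tendsto_average_gradientNoise (k : Fin d ⊕ Fin d) :
    ∀ᵐ ω ∂P, Tendsto (fun t => (∑ i ∈ Finset.range t, α i * gradientNoise η γ Z A y k i ω) /
      ∑ i ∈ Finset.range t, α i) atTop (𝓝 0) := by
  have hk : Continuous fun v : Vec d => v k := PiLp.continuous_apply 2 (fun _ => ℝ) k
  have hc : Continuous fun v : Vec d => mul Aᵀ v k := hk.comp (continuous_mul_const Aᵀ)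
  obtain ⟨K, hK⟩ := exists_bound_of_norm_le hc R
  refine ae_tendsto_weighted_average (K := L + K) history_mono (history_le hZm) (fun t => ?_)
    (fun t => ?_) (isNoise_gradientNoise hZm hZind hZid hAint hA hym hyR k) hα hB hS
  · have hy' := (hym t).mono (history_mono (Nat.le_succ t)) le_rfl
    have h1 := (continuous_transpose_mul (d := d) η γ).measurable.comp
      ((measurable_history_succ (Z := Z) t).prodMk hy')
    exact (hk.measurable.comp h1).sub (hc.measurable.comp hy')
  · filter_upwards [hyR t, hLx t] with ω h1 h2
    exact (abs_sub _ _).trans (add_le_add ((PiLp.norm_apply_le _ k).trans h2) (hK _ h1))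

include hbint hb hym hxR hyR hLx hLy in
lemma ae_tendsto_average_offsetNoise :
    ∀ᵐ ω ∂P, Tendsto (fun t => (∑ i ∈ Finset.range t, α i * offsetNoise η Z b y i ω) /
      ∑ i ∈ Finset.range t, α i) atTop (𝓝 0) := by
  have hc : Continuous fun v : Vec d => inner ℝ v b := by fun_prop
  obtain ⟨K, hK⟩ := exists_bound_of_norm_le hc R
  refine ae_tendsto_weighted_average (K := L * R + R * L + K) history_mono (history_le hZm)
    (fun t => ?_) (fun t => ?_) (isNoise_offsetNoise hZm hZind hZid hbint hb hym hyR) hα hB hS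
  · have hy' := (hym t).mono (history_mono (Nat.le_succ t)) le_rfl
    have h1 := (continuous_sampleVector (d := d) η).measurable.comp
      (measurable_history_succ (Z := Z) t)
    have hi : Continuous fun p : Vec d × Vec d => inner ℝ p.1 p.2 := by fun_prop
    exact (hi.measurable.comp (hy'.prodMk h1)).sub (hc.measurable.comp hy')
  · filter_upwards [hxR t, hyR t, hLx t, hLy t] with ω h1 h2 h3 h4
    refine (abs_sub _ _).trans (add_le_add ?_ (hK _ h2))
    -- No bound on b_t is assumed. The offset is controlled by writing it through the two bounded
    -- subgradients.
    have e : inner ℝ (y t ω) (sampleVector η (Z t ω)) =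
        inner ℝ (mul (sampleMatrix η γ (Z t ω))ᵀ (y t ω)) (x t ω) -
        inner ℝ (y t ω) (mul (sampleMatrix η γ (Z t ω)) (x t ω) - sampleVector η (Z t ω)) := by
      rw [inner_mul_transpose, inner_sub_right]; ring
    rw [e]
    refine (abs_sub _ _).trans (add_le_add ?_ ?_)
    · exact (abs_real_inner_le_norm _ _).trans
        (mul_le_mul h3 h1 (norm_nonneg _) ((norm_nonneg _).trans h3))
    · exact (abs_real_inner_le_norm _ _).trans
        (mul_le_mul h2 h4 (norm_nonneg _) ((norm_nonneg _).trans h2))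

include hAint hbint hA hb hxm hym hxR hyR hLx hLy in
/-- The averaged gap noise vanishes uniformly over bounded reference pairs. -/
lemma ae_exists_gapNoise_bound (r : ℝ) :
    ∀ᵐ ω ∂P, ∃ e : ℕ → ℝ, Tendsto e atTop (𝓝 0) ∧ ∀ v u : Vec d, ‖v‖ ≤ r → ‖u‖ ≤ r → ∀ t,
      |(∑ i ∈ Finset.range t, α i * gapNoise η γ Z A b x y v u i ω) /
        ∑ i ∈ Finset.range t, α i| ≤ e t := by
  have h1 := ae_all_iff.2 fun k => ae_tendsto_average_residualNoise hZm hZind hZid hAint hbint hA hb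
    hxm hxR hLy hα hB hS k
  have h2 := ae_all_iff.2 fun k => ae_tendsto_average_gradientNoise hZm hZind hZid hAint hA
    hym hyR hLx hα hB hS k
  filter_upwards [h1, h2, ae_tendsto_average_offsetNoise hZm hZind hZid hbint hb hym
    hxR hyR hLx hLy hα hB hS] with ω h1 h2 h3
  set a := fun (f : ℕ → Ω → ℝ) t =>
    (∑ i ∈ Finset.range t, α i * f i ω) / ∑ i ∈ Finset.range t, α i with ha
  refine ⟨fun t => (∑ k, r * |a (residualNoise η γ Z A b x k) t|) +
    (∑ k, r * |a (gradientNoise η γ Z A y k) t|) + |a (offsetNoise η Z b y) t|, ?_, ?_⟩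
  · have t1 := tendsto_finsetSum Finset.univ fun k _ => ((h1 k).abs.const_mul r)
    have t2 := tendsto_finsetSum Finset.univ fun k _ => ((h2 k).abs.const_mul r)
    simpa using (t1.add t2).add h3.abs
  · intro v u hv hu t
    have e : (∑ i ∈ Finset.range t, α i * gapNoise η γ Z A b x y v u i ω) /
        ∑ i ∈ Finset.range t, α i = (∑ k, u k * a (residualNoise η γ Z A b x k) t) -
          (∑ k, v k * a (gradientNoise η γ Z A y k) t) + a (offsetNoise η Z b y) t := by
      simp only [ha, gapNoise, _root_.mul_add, mul_sub, Finset.sum_add_distrib,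
        Finset.sum_sub_distrib, add_div, sub_div, Finset.mul_sum, Finset.sum_div]
      congr 2
      · rw [Finset.sum_comm]
        exact Finset.sum_congr rfl fun _ _ => Finset.sum_congr rfl fun _ _ => by ring
      · rw [Finset.sum_comm]
        exact Finset.sum_congr rfl fun _ _ => Finset.sum_congr rfl fun _ _ => by ring
    rw [e]
    have hbd : ∀ (w : Vec d) (f : Fin d ⊕ Fin d → ℝ), ‖w‖ ≤ r →
        |∑ k, w k * f k| ≤ ∑ k, r * |f k| := fun w f hw => by
      refine (Finset.abs_sum_le_sum_abs _ _).trans (Finset.sum_le_sum fun k _ => ?_)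
      rw [abs_mul]
      exact mul_le_mul_of_nonneg_right ((PiLp.norm_apply_le w k).trans hw) (abs_nonneg _)
    exact (abs_add_le _ _).trans (add_le_add_left ((abs_sub _ _).trans
      (add_le_add (hbd u _ hu) (hbd v _ hv))) _)

omit hα hB hS in
include hAint hbint hA hb hxm hym hxR hyR in
lemma isNoise_gapNoise (v u : Vec d) :
    IsNoise P (history Z) (gapNoise η γ Z A b x y v u) := by
  have hmul : ∀ (c : ℝ) {f : ℕ → Ω → ℝ}, IsNoise P (history Z) f →
      IsNoise P (history Z) fun t ω => c * f t ω := fun c f hf t g K hg hK => by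
    have h := hf t g K hg hK
    simp_rw [mul_left_comm _ c, integral_const_mul, h.2, mul_zero]
    exact ⟨h.1.const_mul c, trivial⟩
  have h1 := IsNoise.sum (s := Finset.univ) fun k _ => hmul (u k)
    (isNoise_residualNoise hZm hZind hZid hAint hbint hA hb hxm hxR k)
  have h2 := IsNoise.sum (s := Finset.univ) fun k _ => hmul (v k)
    (isNoise_gradientNoise hZm hZind hZid hAint hA hym hyR k)
  have h3 := hmul (-1) (isNoise_offsetNoise hZm hZind hZid hbint hb hym hyR)
  convert (h1.sub h2).sub h3 using 3 with t ω
  rw [gapNoise]; ring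

end SamplingNoise
-- Averaged iterates and approach to the minimizers.
section Averages
variable {d : ℕ} {α : ℕ → ℝ} (hα : ∀ t, 0 < α t)
include hα

lemma sum_range_succ_pos (t : ℕ) : 0 < ∑ i ∈ Finset.range (t + 1), α i :=
  Finset.sum_pos (fun i _ => hα i) ⟨0, by simp⟩

lemma average_mem {s : Set (Vec d)} (hs : Convex ℝ s) {v : ℕ → Vec d} (hv : ∀ t, v t ∈ s) (t : ℕ) :
    average α v t ∈ s :=
  hs.centerMass_mem (fun i _ => (hα i).le) (sum_range_succ_pos hα t) fun i _ => hv i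

/-- Jensen's inequality in each variable, from convexity in x and concavity in y. -/
lemma gap_average_le {ρ : ℝ} (hρ : 0 ≤ ρ) (A : Matrix (Fin d ⊕ Fin d) (Fin d ⊕ Fin d) ℝ)
    (b : Vec d) (x y : ℕ → Vec d) (v u : Vec d) (t : ℕ) :
    saddle ρ A b (average α x t) u - saddle ρ A b v (average α y t) ≤
      (∑ i ∈ Finset.range (t + 1), α i * (saddle ρ A b (x i) u - saddle ρ A b v (y i))) /
        ∑ i ∈ Finset.range (t + 1), α i := by
  have h1 := (convexOn_saddle A b hρ convex_univ u).map_centerMass_le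
    (t := Finset.range (t + 1)) (w := α) (p := x) (fun i _ => (hα i).le)
    (sum_range_succ_pos hα t) (by simp)
  have h2 := (concaveOn_saddle (ρ := ρ) A b convex_univ v).le_map_centerMass
    (t := Finset.range (t + 1)) (w := α) (p := y) (fun i _ => (hα i).le)
    (sum_range_succ_pos hα t) (by simp)
  simp only [Finset.centerMass, smul_eq_mul] at h1 h2
  simp only [mul_sub, Finset.sum_sub_distrib, sub_div]
  rw [div_eq_inv_mul, div_eq_inv_mul]
  exact sub_le_sub h1 h2

end Averages

/-- A sequence in a compact set along which a continuous function tends to its minimum approaches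
the set of minimizers. -/
lemma tendsto_infDist_argminOn {E : Type*} [PseudoMetricSpace E] {X : Set E} (hX : IsCompact X)
    {f : E → ℝ} (hf : Continuous f) {w : ℕ → E} (hw : ∀ t, w t ∈ X) {p : E}
    (hp : p ∈ argminOn X f) (hlim : ∀ ε > 0, ∀ᶠ t in atTop, f (w t) ≤ f p + ε) :
    Tendsto (fun t => Metric.infDist (w t) (argminOn X f)) atTop (𝓝 0) := by
  rw [tendsto_order]
  refine ⟨fun a ha => Eventually.of_forall fun t => ha.trans_le Metric.infDist_nonneg,
    fun δ hδ => ?_⟩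
  -- On the compact set of points at distance at least δ from the minimizers, the minimum of f, if
  -- the set is nonempty, strictly exceeds f p, so the sequence eventually leaves it.
  set K := X ∩ {z | δ ≤ Metric.infDist z (argminOn X f)} with hK
  have hKc : IsCompact K :=
    hX.inter_right (isClosed_le continuous_const (Metric.continuous_infDist_pt _))
  rcases K.eq_empty_or_nonempty with he | hne
  · refine Eventually.of_forall fun t => ?_
    by_contra! h
    have : w t ∈ K := ⟨hw t, h⟩
    simp [he] at this
  · obtain ⟨z, hz, hmin⟩ := hKc.exists_isMinOn hne hf.continuousOn
    have hlt : f p < f z := by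
      by_contra! hle
      have hz' : z ∈ argminOn X f := ⟨hz.1, fun q hq => hle.trans (hp.2 hq)⟩
      have := hz.2
      rw [Set.mem_ofPred_eq, Metric.infDist_zero_of_mem hz'] at this
      exact this.not_gt hδ
    filter_upwards [hlim ((f z - f p) / 2) (by linarith)] with t ht
    by_contra! h
    have : f z ≤ f (w t) := hmin (show w t ∈ K from ⟨hw t, h⟩)
    linarith

end ROTD

/-! ### Assembly. -/

theorem mainTheorem9 {d : ℕ} {Ω : Type*} [MeasurableSpace Ω] (P : Measure Ω)
    [IsProbabilityMeasure P]
    -- parameters of the algorithm and conjugate exponents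
    (η γ ρ : ℝ) (hρ : 0 ≤ ρ) (m n : ENNReal) (hmn : ENNReal.HolderConjugate m n)
    -- i.i.d. samples whose matrices and vectors have a mean
    (Z : ℕ → Ω → ROTD.Sample d) (hZm : ∀ t, Measurable (Z t)) (hZind : iIndepFun Z P)
    (hZid : ∀ t, IdentDistrib (Z t) (Z 0) P P)
    (hAint : ∀ i j, Integrable (fun ω => ROTD.sampleMatrix η γ (Z 0 ω) i j) P)
    (hbint : ∀ i, Integrable (fun ω => ROTD.sampleVector η (Z 0 ω) i) P)
    (A : Matrix (Fin d ⊕ Fin d) (Fin d ⊕ Fin d) ℝ) (hA : A = ROTD.meanMatrix P η γ (Z 0))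
    (b : ROTD.Vec d) (hb : b = ROTD.meanVector P η (Z 0))
    -- compactness
    (X : Set (ROTD.Vec d)) (hXne : X.Nonempty) (hXcpt : IsCompact X) (hXconv : Convex ℝ X)
    -- the set on which the proximal step is taken, e.g. `X` or the whole space
    (C : Set (ROTD.Vec d)) (hXC : X ⊆ C) (hCclosed : IsClosed C) (hCconv : Convex ℝ C)
    -- the iterates
    (α : ℕ → ℝ) (hα : ∀ t, 0 < α t) (x₀ y₀ : ROTD.Vec d) (hx₀ : x₀ ∈ X)
    (hy₀ : y₀ ∈ ROTD.dualBall d n)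
    (x y : ℕ → Ω → ROTD.Vec d)
    (hx : ∀ t ω, x t ω = (ROTD.iter η γ ρ n C α x₀ y₀ (fun s => Z s ω) t).1)
    (hy : ∀ t ω, y t ω = (ROTD.iter η γ ρ n C α x₀ y₀ (fun s => Z s ω) t).2)
    (hxX : ∀ᵐ ω ∂P, ∀ t, x t ω ∈ X)
    -- bounded stochastic subgradients
    (L : ℝ)
    (hLx : ∀ᵐ ω ∂P, ∀ t, ‖ROTD.mul (ROTD.sampleMatrix η γ (Z t ω))ᵀ (y t ω)‖ ≤ L)
    (hLy : ∀ᵐ ω ∂P, ∀ t,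
      ‖ROTD.mul (ROTD.sampleMatrix η γ (Z t ω)) (x t ω) - ROTD.sampleVector η (Z t ω)‖ ≤ L)
    -- the averaged iterates
    (xbar ybar : ℕ → Ω → ROTD.Vec d)
    (hxbar : ∀ t ω, xbar t ω = ROTD.average α (fun i => x i ω) t)
    (hybar : ∀ t ω, ybar t ω = ROTD.average α (fun i => y i ω) t) :
    -- the loss is the maximum over the dual ball of a convex-concave function
    (∀ v, IsGreatest ((fun u => ROTD.saddle ρ A b v u) '' ROTD.dualBall d n)
        (ROTD.loss m ρ A b v)) ∧
    (∀ u ∈ ROTD.dualBall d n, ConvexOn ℝ X (fun v => ROTD.saddle ρ A b v u)) ∧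
    (∀ v ∈ X, ConcaveOn ℝ (ROTD.dualBall d n) (fun u => ROTD.saddle ρ A b v u)) ∧
    -- its saddle points on `X × Y` exist and give exactly the minimizers of the loss
    (ROTD.argminOn X (ROTD.loss m ρ A b)).Nonempty ∧
    (∀ v ∈ X, v ∈ ROTD.argminOn X (ROTD.loss m ρ A b) ↔
      ∃ u ∈ ROTD.dualBall d n,
        IsSaddlePointOn X (ROTD.dualBall d n) (ROTD.saddle ρ A b) v u) ∧
    -- the minimizers over a large enough `X` are the global minimizers
    (0 < ρ → Metric.closedBall 0 (ROTD.lpNorm m b / ρ) ⊆ X →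
      ROTD.argminOn X (ROTD.loss m ρ A b) = ROTD.argminOn Set.univ (ROTD.loss m ρ A b)) ∧
    -- almost sure convergence to the minimizers
    (Tendsto α atTop (𝓝 0) →
      Tendsto (fun t => ∑ i ∈ Finset.range t, α i) atTop atTop →
      ∀ᵐ ω ∂P, (∀ t, xbar t ω ∈ X) ∧
        Tendsto (fun t => Metric.infDist (xbar t ω) (ROTD.argminOn X (ROTD.loss m ρ A b)))
          atTop (𝓝 0)) ∧
    -- almost surely, error level `α_t L²` of the averaged iterates
    (Antitone α →
      Tendsto (fun t => ∑ i ∈ Finset.range t, α i) atTop atTop →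
      ∀ᵐ ω ∂P, ∀ ε > 0, ∀ᶠ t in atTop,
        ROTD.IsApproxSaddle X (ROTD.dualBall d n) (ROTD.saddle ρ A b)
          (α t * L ^ 2 + ε) (xbar t ω) (ybar t ω)) ∧
    -- finite-time bound in expectation (for a constant step size `a` its last term is `a L²`)
    (Antitone α → ∀ v ∈ X, ∀ u ∈ ROTD.dualBall d n, ∀ t : ℕ,
      Integrable (fun ω => ROTD.saddle ρ A b (xbar t ω) u - ROTD.saddle ρ A b v (ybar t ω)) P ∧
      ∫ ω, (ROTD.saddle ρ A b (xbar t ω) u - ROTD.saddle ρ A b v (ybar t ω)) ∂P ≤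
        (‖x₀ - v‖ ^ 2 + ‖y₀ - u‖ ^ 2 + 2 * α 0 * ρ * ROTD.lpNorm 1 x₀) /
            (2 * ∑ i ∈ Finset.range (t + 1), α i) +
          (∑ i ∈ Finset.range (t + 1), α i ^ 2) / (∑ i ∈ Finset.range (t + 1), α i) *
            L ^ 2) := by
  have hm : Fact (1 ≤ m) := ROTD.fact_one_le_left hmn
  have hn : Fact (1 ≤ n) := ROTD.fact_one_le_left (ENNReal.HolderConjugate.symm (hpq := hmn))
  have hXclosed := hXcpt.isClosed
  have hCne : C.Nonempty := hXne.mono hXC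
  -- the trajectories are adapted to the samples and bounded
  have hiter := ROTD.measurable_iter (η := η) (γ := γ) (n := n) (x₀ := x₀) (y₀ := y₀)
    hρ hα hCclosed hCconv hCne Z
  have hxm : ∀ t, Measurable[ROTD.history Z t] (x t) := fun t => by
    rw [funext (hx t)]; exact (hiter t).fst
  have hym : ∀ t, Measurable[ROTD.history Z t] (y t) := fun t => by
    rw [funext (hy t)]; exact (hiter t).snd
  have hyY : ∀ t ω, y t ω ∈ ROTD.dualBall d n := fun t ω => by
    rw [hy]; exact ROTD.iter_snd_mem hy₀ t
  obtain ⟨R₀, hR₀⟩ := isBounded_iff_forall_norm_le.1 hXcpt.isBounded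
  obtain ⟨R, hRX, hRY⟩ : ∃ R, (∀ v ∈ X, ‖v‖ ≤ R) ∧ ∀ u ∈ ROTD.dualBall d n, ‖u‖ ≤ R :=
    ⟨max R₀ (2 * d), fun v hv => (hR₀ v hv).trans (le_max_left _ _),
      fun u hu => (ROTD.norm_le_of_mem_dualBall n hu).trans (le_max_right _ _)⟩
  have hxR : ∀ t, ∀ᵐ ω ∂P, ‖x t ω‖ ≤ R := fun t => hxX.mono fun ω h => hRX _ (h t)
  have hyR : ∀ t, ∀ᵐ ω ∂P, ‖y t ω‖ ≤ R := fun t => ae_of_all _ fun ω => hRY _ (hyY t ω)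
  have hbound : ∀ᵐ ω ∂P,
      ROTD.SubgradBound η γ ρ n C α x₀ y₀ (fun s => Z s ω) L := by
    filter_upwards [hLx, hLy] with ω h1 h2 t
    rw [← hx, ← hy]
    exact ⟨h1 t, h2 t⟩
  have hgapeq : ∀ v u t ω, ROTD.sampleGap η γ ρ n C α x₀ y₀ (fun s => Z s ω) v u t =
      ROTD.saddle ρ A b (x t ω) u - ROTD.saddle ρ A b v (y t ω) +
        ROTD.gapNoise η γ Z A b x y v u t ω := fun v u t ω => by
    rw [← ROTD.saddle_sub_saddle_eq_add_gapNoise, ROTD.sampleGap, hx, hy]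
  have hSpos := ROTD.sum_range_succ_pos hα
  have hLP : ∀ ω, (∀ t, x t ω ∈ X) → ∀ t, xbar t ω ∈ X := fun ω h t => by
    rw [hxbar]; exact ROTD.average_mem hα hXconv h t
  have hybarY : ∀ ω t, ybar t ω ∈ ROTD.dualBall d n := fun ω t => by
    rw [hybar]; exact ROTD.average_mem hα (ROTD.convex_dualBall n) (fun t => hyY t ω) t
  have hgap : ∀ v u t ω, ROTD.saddle ρ A b (xbar t ω) u - ROTD.saddle ρ A b v (ybar t ω) ≤
      (∑ i ∈ Finset.range (t + 1), α i * ROTD.sampleGap η γ ρ n C α x₀ y₀ (fun s => Z s ω) v u i) /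
        (∑ i ∈ Finset.range (t + 1), α i) -
      (∑ i ∈ Finset.range (t + 1), α i * ROTD.gapNoise η γ Z A b x y v u i ω) /
        (∑ i ∈ Finset.range (t + 1), α i) := fun v u t ω => by
    have h := ROTD.gap_average_le hα hρ A b (fun i => x i ω) (fun i => y i ω) v u t
    rw [← hxbar, ← hybar] at h
    refine h.trans (le_of_eq ?_)
    rw [← sub_div, ← Finset.sum_sub_distrib]
    congr 1
    exact Finset.sum_congr rfl fun i _ => by rw [hgapeq]; ring
  -- from bounds on the sampled gaps to almost sure bounds on the exact gap
  have hae : ∀ {B : ℝ}, (∀ t, α t ≤ B) →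
      Tendsto (fun t => ∑ i ∈ Finset.range t, α i) atTop atTop → ∀ (D K a : ℝ),
      Tendsto (fun t => (∑ i ∈ Finset.range t, α i ^ 2) / ∑ i ∈ Finset.range t, α i) atTop (𝓝 a) →
      (∀ᵐ ω ∂P, ∀ v ∈ X, ∀ u ∈ ROTD.dualBall d n, ∀ t, ∑ i ∈ Finset.range t,
        α i * ROTD.sampleGap η γ ρ n C α x₀ y₀ (fun s => Z s ω) v u i ≤
          D + (∑ i ∈ Finset.range t, α i ^ 2) * K) →
      ∀ᵐ ω ∂P, ∀ ε > 0, ∀ᶠ t in atTop, ∀ v ∈ X, ∀ u ∈ ROTD.dualBall d n,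
        ROTD.saddle ρ A b (xbar t ω) u - ROTD.saddle ρ A b v (ybar t ω) ≤ a * K + ε := by
    intro B hB hS D K a ha hsamp
    filter_upwards [hsamp, ROTD.ae_exists_gapNoise_bound hZm hZind hZid hAint hbint hA hb hxm hym
      hxR hyR (ae_all_iff.1 hLx) (ae_all_iff.1 hLy) hα hB hS R] with ω h1 ⟨e, he, he'⟩ ε hε
    have hlim := ((hS.const_div_atTop D).add (ha.mul_const K)).add he
    rw [zero_add, add_zero] at hlim
    -- The shift by one is needed because the average at time t includes the index t.
    have hev := (tendsto_add_atTop_iff_nat 1).2 hlim |>.eventually_le_const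
      (lt_add_of_pos_right (a * K) hε)
    filter_upwards [hev] with t ht v hv u hu
    refine (hgap v u t ω).trans (le_trans ?_ ht)
    have h2 := div_le_div_of_nonneg_right (h1 v hv u hu (t + 1)) (hSpos t).le
    have h3 := (abs_le.1 (he' v u (hRX v hv) (hRY u hu) (t + 1))).1
    rw [add_div, mul_div_right_comm] at h2
    linarith
  -- A bound on the initial distance uniform in (v, u), so that one threshold for t serves all
  -- reference pairs.
  have hsqdist : ∀ v ∈ X, ∀ u ∈ ROTD.dualBall d n,
      ‖x₀ - v‖ ^ 2 + ‖y₀ - u‖ ^ 2 ≤ 2 * (2 * R) ^ 2 := fun v hv u hu => by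
    have h1 : ‖x₀ - v‖ ≤ 2 * R := by
      linarith [norm_sub_le x₀ v, hRX v hv, hRX x₀ hx₀]
    have h2 : ‖y₀ - u‖ ≤ 2 * R := by
      linarith [norm_sub_le y₀ u, hRY u hu, hRY y₀ hy₀]
    have h3 := pow_le_pow_left₀ (norm_nonneg _) h1 2
    have h4 := pow_le_pow_left₀ (norm_nonneg _) h2 2
    linarith
  have hces : ∀ {a : ℝ}, Tendsto α atTop (𝓝 a) →
      Tendsto (fun t => ∑ i ∈ Finset.range t, α i) atTop atTop →
      Tendsto (fun t => (∑ i ∈ Finset.range t, α i ^ 2) / ∑ i ∈ Finset.range t, α i)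
        atTop (𝓝 a) := fun ha hS => by
    simpa only [sq] using ROTD.tendsto_sum_mul_div_sum (fun t => (hα t).le) hS ha
  refine ⟨ROTD.isGreatest_loss A b hmn,
    fun u _ => ROTD.convexOn_saddle A b hρ hXconv u,
    fun v _ => ROTD.concaveOn_saddle A b (ROTD.convex_dualBall n) v,
    ROTD.argminOn_loss_nonempty A b hXcpt hXne,
    fun v hv => ROTD.mem_argminOn_loss_iff A b hmn hρ hXcpt hXconv hv,
    fun hρ' hball => ROTD.argminOn_loss_eq_univ A b hρ' hball, ?_, ?_, ?_⟩
  · intro hα0 hS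
    obtain ⟨B, hB⟩ := hα0.bddAbove_range
    obtain ⟨p, hp⟩ := ROTD.argminOn_loss_nonempty (m := m) (ρ := ρ) A b hXcpt hXne
    have h := hae (fun t => hB ⟨t, rfl⟩) hS (2 * (2 * R) ^ 2 / 2)
      (((L + ρ * (2 * d)) ^ 2 + L ^ 2) / 2) 0 (hces hα0 hS) (by
        filter_upwards [hbound] with ω hω v hv u hu t
        refine (ROTD.sum_sampleGap_le hρ hα hCclosed hCconv hω (hXC hv) hu t).trans ?_
        linarith [hsqdist v hv u hu])
    filter_upwards [h, hxX] with ω h1 h2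
    refine ⟨hLP ω h2, ROTD.tendsto_infDist_argminOn hXcpt (ROTD.continuous_loss A b)
      (hLP ω h2) hp fun ε hε => ?_⟩
    filter_upwards [h1 ε hε] with t ht
    -- With u attaining F(x̄_t), and φ(p, ȳ_t) ≤ F(p), the gap at (p, u) dominates F(x̄_t) - F(p).
    obtain ⟨u, hu, hu'⟩ := (ROTD.isGreatest_loss (ρ := ρ) A b hmn (xbar t ω)).1
    have h3 := (ROTD.isGreatest_loss (ρ := ρ) A b hmn p).2 ⟨_, hybarY ω t, rfl⟩
    have h4 := ht p hp.1 u hu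
    simp only at h3 hu'
    linarith
  · intro hanti hS
    -- Monotone positive steps converge to some a ≤ α_t, so the limiting level a L² is at most α_t
    -- L².
    obtain ⟨a, ha⟩ : ∃ a, Tendsto α atTop (𝓝 a) :=
      ⟨_, tendsto_atTop_ciInf hanti ⟨0, by rintro _ ⟨t, rfl⟩; exact (hα t).le⟩⟩
    have h := hae (fun t => hanti (Nat.zero_le t)) hS
      ((2 * (2 * R) ^ 2 + 2 * α 0 * ρ * ROTD.lpNorm 1 x₀) / 2) (L ^ 2) a (hces ha hS) (by
        filter_upwards [hbound] with ω hω v hv u hu t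
        refine (ROTD.sum_sampleGap_le_of_antitone hρ hα hCclosed hCconv hω hanti (hXC hv) hu
          t).trans ?_
        linarith [hsqdist v hv u hu])
    filter_upwards [h, hxX] with ω h1 h2 ε hε
    filter_upwards [h1 ε hε] with t ht
    refine ⟨hLP ω h2 t, hybarY ω t, fun v hv u hu => (ht v hv u hu).trans ?_⟩
    have := mul_le_mul_of_nonneg_right (hanti.le_of_tendsto ha t) (sq_nonneg L)
    linarith
  · intro hanti v hv u hu t
    have hcont := ROTD.continuous_saddle ρ A b
    have hint : ∀ {f g : Ω → ROTD.Vec d}, Measurable f → Measurable g → (∀ᵐ ω ∂P, f ω ∈ X) →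
        (∀ ω, g ω ∈ ROTD.dualBall d n) →
        Integrable (fun ω => ROTD.saddle ρ A b (f ω) u - ROTD.saddle ρ A b v (g ω)) P := by
      intro f g hf hg hfX hgY
      obtain ⟨K, hK⟩ := (hXcpt.prod
        (ROTD.isCompact_dualBall (d := d) n)).exists_bound_of_continuousOn
        hcont.continuousOn
      refine Integrable.of_bound (C := K + K) ((hcont.measurable.comp
        (hf.prodMk measurable_const)).sub (hcont.measurable.comp
        (measurable_const.prodMk hg))).aestronglyMeasurable ?_
      filter_upwards [hfX] with ω hω
      exact (norm_sub_le _ _).trans (add_le_add (hK (f ω, u) ⟨hω, hu⟩) (hK (v, g ω) ⟨hv, hgY ω⟩))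
    have hxm' := fun i => (hxm i).mono (ROTD.history_le hZm i) le_rfl
    have hym' := fun i => (hym i).mono (ROTD.history_le hZm i) le_rfl
    have hmavg : ∀ {w : ℕ → Ω → ROTD.Vec d}, (∀ i, Measurable (w i)) →
        Measurable fun ω => ROTD.average α (fun i => w i ω) t := fun {w} hw => by
      have h : Measurable fun ω => ∑ i ∈ Finset.range (t + 1), α i • w i ω :=
        Finset.measurable_sum _ fun i _ => (hw i).const_smul (α i)
      exact h.const_smul (∑ i ∈ Finset.range (t + 1), α i)⁻¹
    have hI : Integrable
        (fun ω => ROTD.saddle ρ A b (xbar t ω) u - ROTD.saddle ρ A b v (ybar t ω)) P := by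
      refine hint ?_ ?_ (hxX.mono fun ω h => hLP ω h t) fun ω => hybarY ω t
      · rw [funext (hxbar t)]; exact hmavg hxm'
      · rw [funext (hybar t)]; exact hmavg hym'
    refine ⟨hI, ?_⟩
    have hN := ROTD.isNoise_gapNoise hZm hZind hZid hAint hbint hA hb hxm hym hxR hyR v u
    have hNsum : Integrable (fun ω => (∑ i ∈ Finset.range (t + 1),
        α i * ROTD.gapNoise η γ Z A b x y v u i ω) / ∑ i ∈ Finset.range (t + 1), α i) P :=
      (integrable_finsetSum _ fun i _ => (hN.integrable i).const_mul (α i)).div_const _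
    have hN0 : ∫ ω, (∑ i ∈ Finset.range (t + 1),
        α i * ROTD.gapNoise η γ Z A b x y v u i ω) / ∑ i ∈ Finset.range (t + 1), α i ∂P = 0 := by
      rw [integral_div, integral_finsetSum _ fun i _ => (hN.integrable i).const_mul (α i)]
      simp_rw [integral_const_mul, hN.integral_eq_zero]
      simp
    set D := (‖x₀ - v‖ ^ 2 + ‖y₀ - u‖ ^ 2 + 2 * α 0 * ρ * ROTD.lpNorm 1 x₀) /
      (2 * ∑ i ∈ Finset.range (t + 1), α i) + (∑ i ∈ Finset.range (t + 1), α i ^ 2) /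
        (∑ i ∈ Finset.range (t + 1), α i) * L ^ 2 with hD
    -- The pathwise bound is a constant minus the averaged noise, whose integral is zero because (v,
    -- u) is deterministic.
    have hle : ∀ᵐ ω ∂P, ROTD.saddle ρ A b (xbar t ω) u - ROTD.saddle ρ A b v (ybar t ω) ≤
        D - (∑ i ∈ Finset.range (t + 1), α i * ROTD.gapNoise η γ Z A b x y v u i ω) /
          ∑ i ∈ Finset.range (t + 1), α i := by
      filter_upwards [hbound] with ω hω
      have h1 := div_le_div_of_nonneg_right (ROTD.sum_sampleGap_le_of_antitone hρ hα hCclosed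
        hCconv hω hanti (hXC hv) hu (t + 1)) (hSpos t).le
      rw [add_div, div_div, mul_div_right_comm] at h1
      linarith [hgap v u t ω]
    refine (integral_mono_ae hI ((integrable_const D).sub hNsum) hle).trans (le_of_eq ?_)
    simp only [Pi.sub_apply]
    rw [integral_sub (integrable_const D) hNsum, hN0]
    simp
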